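/- Let $S=K[x_1,\dots,x_n]$ be a polynomial ring in finitely many variables over a field $K$, and let $M$ be a monomial ideal of $S$ with minimal set of monomial generators $G(M)$. For an integer $k$ and a monomial $l$, $\beta_{k,l}(S/M)$ denotes the number of basis elements of homological degree $k$ and multidegree $l$ in a minimal multigraded free resolution of $S/M$; it is $0$ if $k<0$ or if $l$ is not a monomial (for instance if $l=l'/m$ with $m\nmid l'$). A generator $m\in G(M)$ is dominant if there is a variable $x$ whose exponent in $m$ is larger than its exponent in every other element of $G(M)$, and nondominant otherwise. The ideal $M$ is dominant if all elements of $G(M)$ are dominant, and purely nondominant if all elements of $G(M)$ are nondominant. The first structural decomposition of $M$ is the following finite family of monomial ideals with shifts. If $G(M)$ has no nondominant element, it consists of $M$ alone, with shift $(0,1)$. Otherwise let $h_1,\dots,h_c$ be the nondominant elements of $G(M)$, and let $C$ be the set of pairs $(j,m)$ such that $m$ is the least common multiple of $j\ge 0$ distinct dominant elements of $G(M)$ (so that $(0,1)\in C$); the family consists, for each $(j,m)\in C$, of the ideal $M_m=(h_1',\dots,h_c')$, $h_i'=\operatorname{lcm}(m,h_i)/m$, with shift $(j,m)$. The $r$-fold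 iterated decomposition of $M$ is obtained from $M$ with shift $(0,1)$ by $r$ times replacing simultaneously each ideal $I$ with shift $(j,m)$ by the ideals $I'$ of the first structural decomposition of $I$, where an ideal $I'$ with shift $(j',m')$ in the latter receives the shift $(j+j',mm')$; ideals are counted with multiplicity. **Theorem (second structural decomposition).** Let $p$ be the number of nondominant elements of $G(M)$. Then the $p$-fold iterated decomposition of $M$ is the disjoint union of a finite family $\mathscr D$ of dominant ideals $D$ with shifts $(j_D,m_D)$ and a finite family $\mathscr N$ of purely nondominant ideals $N$ with shifts $(j_N,m_N)$, and for every integer $k$ and every monomial $l$ $$\beta_{k,l}(S/M)=\sum_{D\in\mathscr D}\beta_{k-j_D,\,l/m_D}(S/D)+\sum_{N\in\mathscr N}\beta_{k-j_N,\,l/m_N}(S/N).$$ -/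

import Mathlib

open MvPolynomial

namespace MonomialDecomposition

universe u v

/-- `M` is a monomial ideal of `S = K[x_i : i ∈ σ]`: it is generated by a set of monomials.
Monomials are represented by their exponent vectors in `σ →₀ ℕ`; divisibility is `≤`,
the least common multiple is `⊔`, and the product is `+`. -/
def IsMonomialIdeal {σ : Type u} {K : Type v} [Field K] (M : Ideal (MvPolynomial σ K)) : Prop :=
  ∃ G : Set (σ →₀ ℕ), M = Ideal.span ((fun a => monomial a (1 : K)) '' G)

/-- The minimal monomial generators of `M`: the monomials in `M` that are minimal with respect to
divisibility. -/
def minGenSet {σ : Type u} {K : Type v} [Field K] (M : Ideal (MvPolynomial σ K)) :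
    Set (σ →₀ ℕ) :=
  {a | Minimal (fun b => monomial b (1 : K) ∈ M) a}

theorem minGenSet_finite {σ : Type u} {K : Type v} [Finite σ] [Field K]
    (M : Ideal (MvPolynomial σ K)) : (minGenSet M).Finite := by
  apply WellQuasiOrderedLE.finite_of_isAntichain
  intro a ha b hb hab hle
  exact hab (le_antisymm hle (hb.2 ha.1 hle))

/-- The minimal generating set of the monomial ideal `M`, as a finite set. -/
noncomputable def minGens {σ : Type u} {K : Type v} [Finite σ] [Field K]
    (M : Ideal (MvPolynomial σ K)) : Finset (σ →₀ ℕ) :=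
  (minGenSet_finite M).toFinset

/-- The monomial `m` is dominant in `G`: there is a variable whose exponent in `m` is larger than
its exponent in every other element of `G`. -/
def IsDominantIn {σ : Type u} (G : Finset (σ →₀ ℕ)) (m : σ →₀ ℕ) : Prop :=
  ∃ x : σ, ∀ m' ∈ G, m' ≠ m → m' x < m x

/-- A dominant ideal: a monomial ideal all of whose minimal generators are dominant. -/
def IsDominantIdeal {σ : Type u} {K : Type v} [Finite σ] [Field K]
    (M : Ideal (MvPolynomial σ K)) : Prop :=
  IsMonomialIdeal M ∧ ∀ m ∈ minGens M, IsDominantIn (minGens M) m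

/-- A purely nondominant ideal: a monomial ideal all of whose minimal generators are
nondominant. -/
def IsPurelyNondominantIdeal {σ : Type u} {K : Type v} [Finite σ] [Field K]
    (M : Ideal (MvPolynomial σ K)) : Prop :=
  IsMonomialIdeal M ∧ ∀ m ∈ minGens M, ¬ IsDominantIn (minGens M) m

open Classical in
/-- The dominant minimal generators of `M`. -/
noncomputable def dominantGens {σ : Type u} {K : Type v} [Finite σ] [Field K]
    (M : Ideal (MvPolynomial σ K)) : Finset (σ →₀ ℕ) :=
  (minGens M).filter (fun m => IsDominantIn (minGens M) m)

open Classical in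
/-- The nondominant minimal generators of `M`. -/
noncomputable def nondominantGens {σ : Type u} {K : Type v} [Finite σ] [Field K]
    (M : Ideal (MvPolynomial σ K)) : Finset (σ →₀ ℕ) :=
  (minGens M).filter (fun m => ¬ IsDominantIn (minGens M) m)

/-- A minimal multigraded free resolution
`⋯ → F_2 → F_1 → F_0 → S/M → 0` of `S/M`, with `F_i = S^(rank i)`. The `b`-th basis element of
`F_i` has multidegree `deg i b`. -/
structure MinimalFreeResolution {σ : Type u} {K : Type v} [Field K]
    (M : Ideal (MvPolynomial σ K)) where
  rank : ℕ → ℕ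
  deg : (i : ℕ) → Fin (rank i) → (σ →₀ ℕ)
  d : (i : ℕ) → (Fin (rank (i + 1)) → MvPolynomial σ K) →ₗ[MvPolynomial σ K]
    (Fin (rank i) → MvPolynomial σ K)
  aug : (Fin (rank 0) → MvPolynomial σ K) →ₗ[MvPolynomial σ K] (MvPolynomial σ K ⧸ M)
  /-- The differentials preserve multidegrees: the `(a, b)` entry of the matrix of `d i` is a
  scalar multiple of the monomial `deg b / deg a` (and is zero if `deg a` does not divide
  `deg b`). -/
  d_homogeneous : ∀ (i : ℕ) (a : Fin (rank i)) (b : Fin (rank (i + 1))), ∃ c : K,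
    monomial (deg i a) (1 : K) * d i (Pi.single b 1) a = monomial (deg (i + 1) b) c
  /-- The augmentation preserves multidegrees. -/
  aug_homogeneous : ∀ b : Fin (rank 0), ∃ c : K,
    aug (Pi.single b 1) = Ideal.Quotient.mk M (monomial (deg 0 b) c)
  aug_surjective : Function.Surjective aug
  exact_zero : Function.Exact (d 0) aug
  exact_succ : ∀ i : ℕ, Function.Exact (d (i + 1)) (d i)
  /-- Minimality: no entry of a differential matrix is invertible. -/
  minimal : ∀ (i : ℕ) (a : Fin (rank i)) (b : Fin (rank (i + 1))),
    ¬ IsUnit (d i (Pi.single b 1) a)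

/-- The number of basis elements of homological degree `k` and multidegree `l`. The degrees `k`
and `l` are allowed to be negative; in such degrees there are no basis elements. -/
noncomputable def MinimalFreeResolution.count {σ : Type u} {K : Type v} [Field K]
    {M : Ideal (MvPolynomial σ K)} (F : MinimalFreeResolution M) (k : ℤ) (l : σ → ℤ) : ℕ :=
  Nat.card {b : (i : ℕ) × Fin (F.rank i) //
    (b.1 : ℤ) = k ∧ ∀ x : σ, (F.deg b.1 b.2 x : ℤ) = l x}

open Classical in
/-- The multigraded Betti number `β_{k,l}(S/M)`: the number of basis elements of homological degree
`k` and multidegree `l` in a minimal multigraded free resolution of `S/M`. (For a monomial ideal in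
finitely many variables such a resolution exists and is unique up to isomorphism.) -/
noncomputable def betti {σ : Type u} {K : Type v} [Field K]
    (M : Ideal (MvPolynomial σ K)) (k : ℤ) (l : σ → ℤ) : ℕ :=
  if h : Nonempty (MinimalFreeResolution M) then h.some.count k l else 0

/-- A term of a structural decomposition: an ideal `I` with a shift `(j, m)`, where `m` is a
monomial. It stands for the summand `β_{k - j, l / m}(S/I)`. -/
structure Term (σ : Type u) (K : Type v) [Field K] where
  j : ℕ
  m : σ →₀ ℕ
  I : Ideal (MvPolynomial σ K)

/-- The summand `β_{k - j, l / m}(S/I)` (zero if `k < j` or `m` does not divide `l`). -/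
noncomputable def Term.betti {σ : Type u} {K : Type v} [Field K] (t : Term σ K)
    (k : ℤ) (l : σ →₀ ℕ) : ℕ :=
  MonomialDecomposition.betti t.I (k - t.j) (fun x => (l x : ℤ) - (t.m x : ℤ))

open Classical in
/-- The ideal `M_m` generated by the monomials `lcm(m, h) / m`, where `h` ranges over the
nondominant minimal generators of `M`. -/
noncomputable def quotientIdeal {σ : Type u} {K : Type v} [Finite σ] [Field K]
    (M : Ideal (MvPolynomial σ K)) (m : σ →₀ ℕ) : Ideal (MvPolynomial σ K) :=
  Ideal.span ((fun h => monomial ((m ⊔ h) - m) (1 : K)) '' (nondominantGens M : Set (σ →₀ ℕ)))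

open Classical in
/-- The set of pairs `(j, m)` such that `m` is the least common multiple of `j` distinct dominant
minimal generators of `M`, including `(0, 1)`. -/
noncomputable def shiftSet {σ : Type u} {K : Type v} [Finite σ] [Field K]
    (M : Ideal (MvPolynomial σ K)) : Finset (ℕ × (σ →₀ ℕ)) :=
  (dominantGens M).powerset.image (fun A => (A.card, A.sup id))

open Classical in
/-- The terms of the first structural decomposition of `M`. If `M` has no nondominant minimal
generator, the only term is `M` itself, with trivial shift. Otherwise there is a term `M_m` with
shift `(j, m)` for each `(j, m)` in `shiftSet M`. -/
noncomputable def firstDecomposition {σ : Type u} {K : Type v} [Finite σ] [Field K]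
    (M : Ideal (MvPolynomial σ K)) : Multiset (Term σ K) :=
  if nondominantGens M = ∅ then {⟨0, 0, M⟩}
  else (shiftSet M).val.map (fun p => ⟨p.1, p.2, quotientIdeal M p.2⟩)

/-- The terms obtained from `M` by applying the first structural decomposition `r` times: at each
step every term `I` with shift `(j, m)` is replaced by the terms `I'` of the first structural
decomposition of `I`, the shift `(j', m')` of `I'` being changed to `(j + j', m m')`. -/
noncomputable def iteratedDecomposition {σ : Type u} {K : Type v} [Finite σ] [Field K]
    (M : Ideal (MvPolynomial σ K)) : ℕ → Multiset (Term σ K)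
  | 0 => {⟨0, 0, M⟩}
  | r + 1 => (iteratedDecomposition M r).bind (fun t =>
      (firstDecomposition t.I).map (fun t' => ⟨t.j + t'.j, t.m + t'.m, t'.I⟩))

end MonomialDecomposition

/-!
A multigraded map between free modules over `S = K[x_i : i ∈ σ]` is given, entry by entry, by
scalars times prescribed monomials, and it is exact if and only if it is exact in each
multidegree. So a minimal multigraded free resolution of `S/M` is the same as a complex of
`K`-vector spaces whose basis elements carry multidegrees, whose differential strictly lowers
multidegrees, and whose strands, spanned by the basis elements of multidegree dividing a given
`l`, are resolutions of the components of `S/M` (`ScalarComplex.IsResolution`). Chain maps lifting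
the identity exist and are unique up to homotopy; on the basis elements of one multidegree the
differential of a minimal complex induces zero, so these chain maps induce mutually inverse
isomorphisms there, and the Betti numbers do not depend on the resolution
(`ScalarComplex.card_basisAt_eq`). Resolutions exist, with all multidegrees dividing the least
common multiple `L` of any set of generators (`exists_matrixResolution`): the syzygies in
multidegree `l` depend only on the greatest common divisor of `l` and `L`, so new generators are
needed only in the finitely many multidegrees dividing `L`.

If a monomial `d` does not divide `L`, then the mapping cone of the multiplication by `d`, from
the shifted resolution of `S/(M : d)` to the resolution of `S/M`, is again minimal, because all
multidegrees of the former are divisible by `d` and none of the latter is. Hence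
`β_{k,l}(S/(M + (d))) = β_{k,l}(S/M) + β_{k-1,l/d}(S/(M : d))` (`betti_eq_add_of_exponents_eq_union`). If `M` has
a nondominant generator, then a dominant generator `d` does not divide the least common multiple
of the other generators, and in `M : d` the other dominant generators stay dominant. Splitting off
all dominant generators in this way gives a sum over the sets of dominant generators
(`betti_eq_sum_powerset`), which is the formula for the first structural decomposition
(`sum_firstDecomposition`), since a set of dominant generators is determined by its least common
multiple. The formula for the iterated decomposition follows by induction.

Finally, an ideal of the first structural decomposition has at most as many generators as `M` has
nondominant ones. So either all of its generators are nondominant, or it has fewer nondominant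
generators than `M` (`card_nondominantGens_lt`). As dominant and purely nondominant ideals are
reproduced by the decomposition, only such ideals are left after `p` steps.
-/

namespace MonomialDecomposition

/-! ### Multigraded complexes over the field -/

section Supported

variable {K W B : Type*} [Field K] [AddCommGroup W] [Module K W]

theorem map_mem_of_mem_supported {s : Set B} {f : (B →₀ K) →ₗ[K] W} {N : Submodule K W}
    (h : ∀ b ∈ s, f (Finsupp.single b 1) ∈ N) {v : B →₀ K} (hv : v ∈ Finsupp.supported K K s) :
    f v ∈ N := by
  rw [Finsupp.supported_eq_span_single] at hv
  have : Submodule.span K ((fun i => Finsupp.single i (1 : K)) '' s) ≤ N.comap f := by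
    rw [Submodule.span_le]
    rintro _ ⟨b, hb, rfl⟩
    exact h b hb
  exact this hv

theorem map_eq_of_mem_supported {s : Set B} {f g : (B →₀ K) →ₗ[K] W}
    (h : ∀ b ∈ s, f (Finsupp.single b 1) = g (Finsupp.single b 1)) {v : B →₀ K}
    (hv : v ∈ Finsupp.supported K K s) : f v = g v := by
  have := map_mem_of_mem_supported (f := f - g) (N := ⊥) (s := s)
    (by intro b hb; simp [h b hb]) hv
  simpa [sub_eq_zero] using this

end Supported

/-- The scalar form of a minimal multigraded complex of free modules over `K[x_i : i ∈ σ]`,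
together with an augmentation. The basis elements in all homological degrees form one type `B`;
`hdeg` is the homological degree and `deg` the multidegree. The entry of a multigraded differential
between basis elements of multidegrees `a ≤ b` is a scalar times the monomial `b - a`, and only the
scalars are recorded, so that the differential is a linear map over `K`; minimality says that it
strictly lowers multidegrees. -/
structure ScalarComplex (σ : Type*) (K : Type*) [Field K] where
  B : Type
  hdeg : B → ℕ
  deg : B → σ →₀ ℕ
  D : (B →₀ K) →ₗ[K] (B →₀ K)
  ε : (B →₀ K) →ₗ[K] K
  D_mem : ∀ b, D (Finsupp.single b 1) ∈
    Finsupp.supported K K {a | hdeg a + 1 = hdeg b ∧ deg a < deg b}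

namespace ScalarComplex

variable {σ : Type*} {K : Type*} [Field K]

/-- The strand in multidegree `l` of the `n`-th module: it is spanned by the basis elements of
homological degree `n` whose multidegree divides `l`. -/
def strand (C : ScalarComplex σ K) (n : ℕ) (l : σ →₀ ℕ) : Submodule K (C.B →₀ K) :=
  Finsupp.supported K K {b | C.hdeg b = n ∧ C.deg b ≤ l}

/-- `C` is a (minimal) resolution of `S/M`, where `I` is the set of exponents of the monomials
in `M`: in each multidegree `l`, the strands of `C` form a resolution of the component of `S/M`,
which is `K` if `l ∉ I` and `0` if `l ∈ I`. -/
structure IsResolution (C : ScalarComplex σ K) (I : Set (σ →₀ ℕ)) : Prop where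
  finite : ∀ n, {b | C.hdeg b = n}.Finite
  D_D : ∀ b, C.D (C.D (Finsupp.single b 1)) = 0
  ε_D : ∀ b, C.hdeg b = 1 → C.deg b ∈ I ∨ C.ε (C.D (Finsupp.single b 1)) = 0
  exact_succ : ∀ n l, ∀ v ∈ C.strand (n + 1) l, C.D v = 0 → ∃ w ∈ C.strand (n + 2) l, C.D w = v
  exact_zero : ∀ l, ∀ v ∈ C.strand 0 l, (l ∈ I ∨ C.ε v = 0) → ∃ w ∈ C.strand 1 l, C.D w = v
  surjective : ∀ l ∉ I, ∃ v ∈ C.strand 0 l, C.ε v = 1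

variable {C C' : ScalarComplex σ K} {I : Set (σ →₀ ℕ)}

theorem single_mem_strand {b : C.B} {n : ℕ} {l : σ →₀ ℕ} (hn : C.hdeg b = n) (hl : C.deg b ≤ l)
    (r : K) : Finsupp.single b r ∈ C.strand n l :=
  Finsupp.single_mem_supported K r ⟨hn, hl⟩

theorem strand_mono (C : ScalarComplex σ K) (n : ℕ) {l l' : σ →₀ ℕ} (h : l ≤ l') :
    C.strand n l ≤ C.strand n l' :=
  Finsupp.supported_mono fun _ hb => ⟨hb.1, hb.2.trans h⟩

theorem D_single_eq_zero {b : C.B} (hb : C.hdeg b = 0) : C.D (Finsupp.single b 1) = 0 := by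
  have h := C.D_mem b
  have : {a | C.hdeg a + 1 = C.hdeg b ∧ C.deg a < C.deg b} = ∅ := by
    ext a
    simp [hb]
  rw [this, Finsupp.supported_empty] at h
  simpa using h

theorem D_eq_zero {l : σ →₀ ℕ} {v : C.B →₀ K} (hv : v ∈ C.strand 0 l) : C.D v = 0 :=
  map_eq_of_mem_supported (g := 0) (fun _ hb => by simpa using D_single_eq_zero hb.1) hv

theorem D_single_mem {n : ℕ} {b : C.B} (hb : C.hdeg b = n + 1) :
    C.D (Finsupp.single b 1) ∈ C.strand n (C.deg b) :=
  Finsupp.supported_mono (fun _ ha => And.intro (by have := ha.1; omega) ha.2.le) (C.D_mem b)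

theorem IsResolution.D_D_apply (hC : C.IsResolution I) (v : C.B →₀ K) : C.D (C.D v) = 0 :=
  map_eq_of_mem_supported (f := C.D ∘ₗ C.D) (g := 0) (s := Set.univ)
    (fun b _ => by simpa using hC.D_D b) (by simp)

theorem IsResolution.ε_D_apply (hC : C.IsResolution I) (hI : IsUpperSet I) {l : σ →₀ ℕ}
    (hl : l ∉ I) {v : C.B →₀ K} (hv : v ∈ C.strand 1 l) : C.ε (C.D v) = 0 :=
  map_eq_of_mem_supported (f := C.ε ∘ₗ C.D) (g := 0)
    (fun b hb => by
      rcases hC.ε_D b hb.1 with h | h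
      · exact absurd (hI hb.2 h) hl
      · simpa using h) hv

/-- A linear map on a complex can be built by recursion on the homological degree, the image of a
basis element being chosen in terms of the image of its boundary. -/
theorem exists_linearMap_of_step (C : ScalarComplex σ K) {W : Type*} [AddCommGroup W] [Module K W]
    (Q : C.B → W → W → Prop)
    (h0 : ∀ b, C.hdeg b = 0 → ∃ w, Q b w 0)
    (h1 : ∀ (n : ℕ) (f : (C.B →₀ K) →ₗ[K] W),
      (∀ b, C.hdeg b ≤ n → Q b (f (Finsupp.single b 1)) (f (C.D (Finsupp.single b 1)))) →
      ∀ b, C.hdeg b = n + 1 → ∃ w, Q b w (f (C.D (Finsupp.single b 1)))) :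
    ∃ f : (C.B →₀ K) →ₗ[K] W,
      ∀ b, Q b (f (Finsupp.single b 1)) (f (C.D (Finsupp.single b 1))) := by
  classical
  let T : ℕ → Type _ := fun n => {f : (C.B →₀ K) →ₗ[K] W //
    ∀ b, C.hdeg b ≤ n → Q b (f (Finsupp.single b 1)) (f (C.D (Finsupp.single b 1)))}
  have hDle : ∀ (b : C.B) (f g : (C.B →₀ K) →ₗ[K] W),
      (∀ a, C.hdeg a + 1 = C.hdeg b → f (Finsupp.single a 1) = g (Finsupp.single a 1)) →
      f (C.D (Finsupp.single b 1)) = g (C.D (Finsupp.single b 1)) := fun b f g h =>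
    map_eq_of_mem_supported (fun a ha => h a ha.1) (C.D_mem b)
  have start : Nonempty (T 0) := by
    choose! w hw using h0
    refine ⟨⟨Finsupp.linearCombination K w, fun b hb => ?_⟩⟩
    have hb : C.hdeg b = 0 := by omega
    rw [D_single_eq_zero hb]
    simpa using hw b hb
  have next : ∀ n (f : T n), ∃ g : T (n + 1), ∀ b, C.hdeg b ≤ n →
      g.1 (Finsupp.single b 1) = f.1 (Finsupp.single b 1) := by
    rintro n ⟨f, hf⟩
    have := h1 n f hf
    choose! w hw using this
    let g := Finsupp.linearCombination K
      (fun b => if C.hdeg b ≤ n then f (Finsupp.single b 1) else w b)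
    have hg : ∀ b, C.hdeg b ≤ n → g (Finsupp.single b 1) = f (Finsupp.single b 1) := by
      intro b hb
      simp [g, hb]
    refine ⟨⟨g, fun b hb => ?_⟩, hg⟩
    rw [hDle b g f fun a ha => hg a (by omega)]
    rcases Nat.lt_or_ge n (C.hdeg b) with h | h
    · have h' : C.hdeg b = n + 1 := by omega
      have : g (Finsupp.single b 1) = w b := by simp [g, h']
      rw [this]
      exact hw b h'
    · rw [hg b h]
      exact hf b h
  choose nx hnx using next
  let Φ : (n : ℕ) → T n := fun n => Nat.rec start.some (fun n f => nx n f) n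
  have hΦ : ∀ n b, C.hdeg b ≤ n →
      (Φ (n + 1)).1 (Finsupp.single b 1) = (Φ n).1 (Finsupp.single b 1) := fun n => hnx n (Φ n)
  let φ := Finsupp.linearCombination K (fun b => (Φ (C.hdeg b)).1 (Finsupp.single b 1))
  have hφ : ∀ b, φ (Finsupp.single b 1) = (Φ (C.hdeg b)).1 (Finsupp.single b 1) := by simp [φ]
  refine ⟨φ, fun b => ?_⟩
  rw [hφ b, hDle b φ (Φ (C.hdeg b)).1]
  · exact (Φ (C.hdeg b)).2 b le_rfl
  · intro a ha
    rw [hφ a, ← ha, hΦ _ _ le_rfl]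

/-- The comparison theorem: the identity of `S/M`, and more generally a homomorphism to `S/M` from
the module presented by `C`, lifts to a multigraded chain map to a resolution of `S/M`. -/
theorem exists_chainMap (hDD : ∀ b, C.D (C.D (Finsupp.single b 1)) = 0)
    (hε : ∀ b, C.hdeg b = 1 → C.deg b ∈ I ∨ C.ε (C.D (Finsupp.single b 1)) = 0)
    (hI : IsUpperSet I) (hC' : C'.IsResolution I) :
    ∃ φ : (C.B →₀ K) →ₗ[K] (C'.B →₀ K),
      (∀ b, φ (Finsupp.single b 1) ∈ C'.strand (C.hdeg b) (C.deg b)) ∧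
      (∀ b, C'.D (φ (Finsupp.single b 1)) = φ (C.D (Finsupp.single b 1))) ∧
      ∀ b, C.hdeg b = 0 →
        C.deg b ∈ I ∨ C'.ε (φ (Finsupp.single b 1)) = C.ε (Finsupp.single b 1) := by
  suffices h : ∃ φ : (C.B →₀ K) →ₗ[K] (C'.B →₀ K), ∀ b,
      φ (Finsupp.single b 1) ∈ C'.strand (C.hdeg b) (C.deg b) ∧
      C'.D (φ (Finsupp.single b 1)) = φ (C.D (Finsupp.single b 1)) ∧
      (C.hdeg b = 0 → C.deg b ∈ I ∨ C'.ε (φ (Finsupp.single b 1)) = C.ε (Finsupp.single b 1)) by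
    simpa only [forall_and] using h
  refine C.exists_linearMap_of_step
    (fun b w u => w ∈ C'.strand (C.hdeg b) (C.deg b) ∧ C'.D w = u ∧
      (C.hdeg b = 0 → C.deg b ∈ I ∨ C'.ε w = C.ε (Finsupp.single b 1))) ?_ ?_
  · intro b hb
    rw [hb]
    by_cases hbI : C.deg b ∈ I
    · exact ⟨0, Submodule.zero_mem _, map_zero _, fun _ => Or.inl hbI⟩
    · obtain ⟨v, hv, hv1⟩ := hC'.surjective _ hbI
      have hv' := Submodule.smul_mem _ (C.ε (Finsupp.single b 1)) hv
      exact ⟨C.ε (Finsupp.single b 1) • v, hv', D_eq_zero hv', fun _ => Or.inr (by simp [hv1])⟩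
  · intro n f hf b hb
    rw [hb]
    have hmem : f (C.D (Finsupp.single b 1)) ∈ C'.strand n (C.deg b) :=
      map_mem_of_mem_supported (fun a ha => C'.strand_mono n ha.2 (ha.1 ▸ (hf a ha.1.le).1))
        (D_single_mem hb)
    rcases n with _ | n
    · obtain ⟨w, hw, hw'⟩ := hC'.exact_zero _ _ hmem (by
        by_cases hbI : C.deg b ∈ I
        · exact Or.inl hbI
        · right
          rw [← (hε b hb).resolve_left hbI]
          refine map_eq_of_mem_supported (f := C'.ε ∘ₗ f) (fun a ha => ?_) (D_single_mem hb)
          exact ((hf a ha.1.le).2.2 ha.1).resolve_left fun h => hbI (hI ha.2 h))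
      exact ⟨w, hw, hw', fun h => by omega⟩
    · obtain ⟨w, hw, hw'⟩ := hC'.exact_succ _ _ _ hmem (by
        have : C'.D (f (C.D (Finsupp.single b 1))) = f (C.D (C.D (Finsupp.single b 1))) :=
          map_eq_of_mem_supported (f := C'.D ∘ₗ f) (g := f ∘ₗ C.D)
            (fun a ha => (hf a ha.1.le).2.1) (D_single_mem hb)
        rw [this, hDD, map_zero])
      exact ⟨w, hw, hw', fun h => by omega⟩

/-- A chain endomorphism of a resolution that lifts zero is null-homotopic. -/
theorem exists_homotopy (hC : C.IsResolution I)
    {θ : (C.B →₀ K) →ₗ[K] (C.B →₀ K)}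
    (hθ : ∀ b, θ (Finsupp.single b 1) ∈ C.strand (C.hdeg b) (C.deg b))
    (hθD : ∀ b, C.D (θ (Finsupp.single b 1)) = θ (C.D (Finsupp.single b 1)))
    (hθε : ∀ b, C.hdeg b = 0 → C.deg b ∈ I ∨ C.ε (θ (Finsupp.single b 1)) = 0) :
    ∃ η : (C.B →₀ K) →ₗ[K] (C.B →₀ K),
      (∀ b, η (Finsupp.single b 1) ∈ C.strand (C.hdeg b + 1) (C.deg b)) ∧
      ∀ b, C.D (η (Finsupp.single b 1)) = θ (Finsupp.single b 1) -
        η (C.D (Finsupp.single b 1)) := by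
  suffices h : ∃ η : (C.B →₀ K) →ₗ[K] (C.B →₀ K), ∀ b,
      η (Finsupp.single b 1) ∈ C.strand (C.hdeg b + 1) (C.deg b) ∧
      C.D (η (Finsupp.single b 1)) = θ (Finsupp.single b 1) - η (C.D (Finsupp.single b 1)) by
    simpa only [forall_and] using h
  refine C.exists_linearMap_of_step
    (fun b w u => w ∈ C.strand (C.hdeg b + 1) (C.deg b) ∧ C.D w = θ (Finsupp.single b 1) - u) ?_ ?_
  · intro b hb
    have := hC.exact_zero _ _ (hb ▸ hθ b) (hθε b hb)
    simpa [hb] using this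
  · intro n f hf b hb
    have hmem : f (C.D (Finsupp.single b 1)) ∈ C.strand (n + 1) (C.deg b) :=
      map_mem_of_mem_supported (fun a ha => C.strand_mono _ ha.2 (ha.1 ▸ (hf a ha.1.le).1))
        (D_single_mem hb)
    have hθb := hθ b
    rw [hb] at hθb ⊢
    refine hC.exact_succ _ _ _ (Submodule.sub_mem _ hθb hmem) ?_
    have : C.D (f (C.D (Finsupp.single b 1))) =
        (θ - f ∘ₗ C.D) (C.D (Finsupp.single b 1)) :=
      map_eq_of_mem_supported (f := C.D ∘ₗ f) (fun a ha => (hf a ha.1.le).2) (D_single_mem hb)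
    rw [map_sub, this, hθD]
    simp [hC.D_D]

/-- The basis elements of homological degree `k` and multidegree `l`. -/
def basisAt (C : ScalarComplex σ K) (k : ℕ) (l : σ →₀ ℕ) : Set C.B :=
  {b | C.hdeg b = k ∧ C.deg b = l}

theorem IsResolution.finite_basisAt (hC : C.IsResolution I) (k : ℕ) (l : σ →₀ ℕ) :
    (C.basisAt k l).Finite :=
  (hC.finite k).subset fun _ hb => hb.1

theorem card_basisAt_le (hI : IsUpperSet I) (hC : C.IsResolution I) (hC' : C'.IsResolution I)
    (k : ℕ) (l : σ →₀ ℕ) : Nat.card (C.basisAt k l) ≤ Nat.card (C'.basisAt k l) := by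
  obtain ⟨φ, hφ, hφD, hφε⟩ := exists_chainMap hC.D_D hC.ε_D hI hC'
  obtain ⟨ψ, hψ, hψD, hψε⟩ := exists_chainMap hC'.D_D hC'.ε_D hI hC
  have hψs : ∀ {n l v}, v ∈ C'.strand n l → ψ v ∈ C.strand n l := fun hv =>
    map_mem_of_mem_supported (fun b hb => C.strand_mono _ hb.2 (hb.1 ▸ hψ b)) hv
  have hψDv : ∀ v, C.D (ψ v) = ψ (C'.D v) := fun v =>
    map_eq_of_mem_supported (f := C.D ∘ₗ ψ) (g := ψ ∘ₗ C'.D) (s := Set.univ)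
      (fun b _ => hψD b) (by simp)
  obtain ⟨η, hη, hηD⟩ := exists_homotopy hC (θ := ψ ∘ₗ φ - LinearMap.id)
    (fun b => Submodule.sub_mem _ (hψs (hφ b)) (single_mem_strand rfl le_rfl 1))
    (fun b => by simp [hψDv, hφD])
    (fun b hb => by
      by_cases hbI : C.deg b ∈ I
      · exact Or.inl hbI
      · right
        have h1 : C.ε (ψ (φ (Finsupp.single b 1))) = C'.ε (φ (Finsupp.single b 1)) :=
          map_eq_of_mem_supported (f := C.ε ∘ₗ ψ)
            (fun a ha => (hψε a (ha.1.trans hb)).resolve_left fun h => hbI (hI ha.2 h)) (hφ b)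
        have h2 := (hφε b hb).resolve_left hbI
        simp [h1, h2])
  -- the homotopy shows that `ψ ∘ φ` is the identity modulo multidegrees smaller than `l`
  have hlow : ∀ b ∈ C.basisAt k l,
      ψ (φ (Finsupp.single b 1)) - Finsupp.single b 1 ∈
        Finsupp.supported K K {a | C.deg a < l} := by
    intro b hb
    have : ψ (φ (Finsupp.single b 1)) - Finsupp.single b 1 =
        C.D (η (Finsupp.single b 1)) + η (C.D (Finsupp.single b 1)) := by
      rw [hηD]; simp
    rw [this]
    refine Submodule.add_mem _ ?_ ?_
    · refine map_mem_of_mem_supported (fun a ha => ?_) (hη b)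
      exact Finsupp.supported_mono (fun c hc => lt_of_lt_of_le hc.2 (hb.2 ▸ ha.2)) (C.D_mem a)
    · refine map_mem_of_mem_supported (fun a ha => ?_) (C.D_mem b)
      exact Finsupp.supported_mono (fun c hc => lt_of_le_of_lt hc.2 (hb.2 ▸ ha.2)) (hη a)
  have hf := hC.finite_basisAt k l
  have hf' := hC'.finite_basisAt k l
  have := hf.fintype
  have := hf'.fintype
  -- `F` and `F'` are the blocks of `φ` and `ψ` at the basis elements of bidegree `(k, l)`
  let F : (C.basisAt k l →₀ K) →ₗ[K] (C'.basisAt k l →₀ K) :=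
    Finsupp.lsubtypeDomain _ ∘ₗ φ ∘ₗ Finsupp.lmapDomain K K Subtype.val
  let F' : (C'.basisAt k l →₀ K) →ₗ[K] (C.basisAt k l →₀ K) :=
    Finsupp.lsubtypeDomain _ ∘ₗ ψ ∘ₗ Finsupp.lmapDomain K K Subtype.val
  have hFF : F' ∘ₗ F = LinearMap.id := by
    ext b a
    obtain ⟨b, hb⟩ := b
    obtain ⟨a, ha⟩ := a
    set u := φ (Finsupp.single b 1) with hu
    have hus : u ∈ C'.strand k l := hb.1 ▸ hb.2 ▸ hφ b
    set w := Finsupp.mapDomain Subtype.val (Finsupp.subtypeDomain (C'.basisAt k l) u) with hw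
    -- the part of `φ b` outside the block has smaller multidegree, so `ψ` maps it outside the block
    have huw : u - w ∈ Finsupp.supported K K {c | C'.hdeg c = k ∧ C'.deg c < l} := by
      rw [Finsupp.mem_supported']
      intro c hc
      by_cases hcl : c ∈ C'.basisAt k l
      · have : w c = u c := by
          have := Finsupp.mapDomain_apply Subtype.val_injective
            (Finsupp.subtypeDomain (C'.basisAt k l) u) ⟨c, hcl⟩
          rw [hw]
          exact this
        simp [this]
      · have h1 : w c = 0 := Finsupp.mapDomain_of_notMem_range _ _ (by
          rintro ⟨x, rfl⟩
          exact hcl x.2)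
        have h2 : u c = 0 := by
          refine (Finsupp.mem_supported' K u).1 hus c fun h => hc ⟨h.1, lt_of_le_of_ne h.2 ?_⟩
          exact fun h' => hcl ⟨h.1, h'⟩
        simp [h1, h2]
    have h3 : ψ (u - w) ∈ Finsupp.supported K K {a | C.deg a < l} :=
      map_mem_of_mem_supported (fun c hc =>
        Finsupp.supported_mono (fun e he => lt_of_le_of_lt he.2 hc.2) (hψ c)) huw
    have hal : a ∉ {a | C.deg a < l} := fun h => by
      simp only [Set.mem_ofPred_eq, ha.2] at h
      exact lt_irrefl _ h
    have h4 := (Finsupp.mem_supported' K _).1 h3 a hal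
    have h5 := (Finsupp.mem_supported' K _).1 (hlow b hb) a hal
    have h6 : ψ w a = Finsupp.single b 1 a := by
      rw [map_sub, Finsupp.sub_apply, sub_eq_zero] at h4
      rw [← h4]
      rw [Finsupp.sub_apply, sub_eq_zero] at h5
      exact h5
    have h7 : (F' (F (Finsupp.single ⟨b, hb⟩ 1))) ⟨a, ha⟩ = ψ w a := by
      simp only [F, F', LinearMap.comp_apply, Finsupp.lmapDomain_apply, Finsupp.mapDomain_single]
      rfl
    change (F' (F (Finsupp.single (⟨b, hb⟩ : C.basisAt k l) (1 : K)))) ⟨a, ha⟩ =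
      Finsupp.single (⟨b, hb⟩ : C.basisAt k l) (1 : K) ⟨a, ha⟩
    rw [h7, h6]
    exact Finsupp.single_apply_left Subtype.val_injective (⟨b, hb⟩ : C.basisAt k l) ⟨a, ha⟩ (1 : K)
  have hinj : Function.Injective F := by
    refine Function.LeftInverse.injective (g := F') fun x => ?_
    rw [← LinearMap.comp_apply, hFF, LinearMap.id_apply]
  have := LinearMap.finrank_le_finrank_of_injective hinj
  simpa [Module.finrank_finsupp_self, Nat.card_eq_fintype_card] using this

/-- Two minimal resolutions of the same quotient have the same number of basis elements in each
bidegree. -/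
theorem card_basisAt_eq (hI : IsUpperSet I) (hC : C.IsResolution I) (hC' : C'.IsResolution I)
    (k : ℕ) (l : σ →₀ ℕ) : Nat.card (C.basisAt k l) = Nat.card (C'.basisAt k l) :=
  (card_basisAt_le hI hC hC' k l).antisymm (card_basisAt_le hI hC' hC k l)

end ScalarComplex

/-! ### Shifts and mapping cones -/

namespace ScalarComplex

variable {σ : Type*} {K : Type*} [Field K]

/-- The complex `C` with all multidegrees shifted by `d`. -/
noncomputable def shift (C : ScalarComplex σ K) (d : σ →₀ ℕ) : ScalarComplex σ K where
  B := C.B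
  hdeg := C.hdeg
  deg b := C.deg b + d
  D := C.D
  ε := C.ε
  D_mem b := Finsupp.supported_mono
    (fun _ ha => And.intro ha.1 (add_lt_add_left ha.2 d)) (C.D_mem b)

/-- `E` is a (minimal) resolution of the ideal of `S/M` generated by the monomial `d`, where `I` is
the set of exponents of the monomials in `M`. The component of this ideal in multidegree `l` is `K`
if `l ∉ I` and `d ≤ l`, and `0` otherwise. -/
structure IsShiftedResolution (E : ScalarComplex σ K) (d : σ →₀ ℕ) (I : Set (σ →₀ ℕ)) : Prop where
  finite : ∀ n, {b | E.hdeg b = n}.Finite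
  le_deg : ∀ b, d ≤ E.deg b
  D_D : ∀ v, E.D (E.D v) = 0
  ε_D : ∀ b, E.hdeg b = 1 → E.deg b ∈ I ∨ E.ε (E.D (Finsupp.single b 1)) = 0
  exact_succ : ∀ n l, ∀ v ∈ E.strand (n + 1) l, E.D v = 0 → ∃ w ∈ E.strand (n + 2) l, E.D w = v
  exact_zero : ∀ l, ∀ v ∈ E.strand 0 l, (l ∈ I ∨ E.ε v = 0) → ∃ w ∈ E.strand 1 l, E.D w = v
  surjective : ∀ l ∉ I, d ≤ l → ∃ v ∈ E.strand 0 l, E.ε v = 1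

theorem strand_shift (C : ScalarComplex σ K) {d l : σ →₀ ℕ} (h : d ≤ l) (n : ℕ) :
    (C.shift d).strand n l = C.strand n (l - d) := by
  unfold strand shift
  congr 1
  ext b
  simp [le_tsub_iff_right h]

theorem eq_zero_of_mem_strand {E : ScalarComplex σ K} {d l : σ →₀ ℕ} (hE : ∀ b, d ≤ E.deg b)
    (h : ¬ d ≤ l) {n : ℕ} {v : E.B →₀ K} (hv : v ∈ E.strand n l) : v = 0 := by
  have : {b : E.B | E.hdeg b = n ∧ E.deg b ≤ l} = ∅ := by
    ext b
    simp only [Set.mem_ofPred_eq, Set.mem_empty_iff_false, iff_false, not_and]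
    exact fun _ h' => h ((hE b).trans h')
  rw [strand, this, Finsupp.supported_empty] at hv
  simpa using hv

/-- The ideal of `S/M` generated by `d` is the shift by `d` of `S/(M : d)`. -/
theorem IsResolution.shift {C : ScalarComplex σ K} {d : σ →₀ ℕ} {I : Set (σ →₀ ℕ)}
    (hC : C.IsResolution {l | l + d ∈ I}) : (C.shift d).IsShiftedResolution d I where
  finite := hC.finite
  le_deg _ := le_add_self
  D_D := hC.D_D_apply
  ε_D := hC.ε_D
  exact_succ n l v hv h0 := by
    by_cases hd : d ≤ l
    · rw [strand_shift _ hd] at hv ⊢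
      exact hC.exact_succ _ _ _ hv h0
    · exact ⟨0, Submodule.zero_mem _,
        by rw [eq_zero_of_mem_strand (fun _ => le_add_self) hd hv, map_zero]⟩
  exact_zero l v hv h0 := by
    by_cases hd : d ≤ l
    · rw [strand_shift _ hd] at hv ⊢
      refine hC.exact_zero _ _ hv (h0.imp_left fun h => ?_)
      simpa [tsub_add_cancel_of_le hd] using h
    · exact ⟨0, Submodule.zero_mem _,
        by rw [eq_zero_of_mem_strand (fun _ => le_add_self) hd hv, map_zero]⟩
  surjective l hl hd := by
    rw [strand_shift _ hd]
    exact hC.surjective (l - d) (by simpa [tsub_add_cancel_of_le hd] using hl)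

theorem mem_supported_sum_iff {A B : Type*} {s : Set (A ⊕ B)} {v : A ⊕ B →₀ K} :
    v ∈ Finsupp.supported K K s ↔
      (Finsupp.sumFinsuppLEquivProdFinsupp K v).1 ∈ Finsupp.supported K K (Sum.inl ⁻¹' s) ∧
      (Finsupp.sumFinsuppLEquivProdFinsupp K v).2 ∈ Finsupp.supported K K (Sum.inr ⁻¹' s) := by
  simp [Finsupp.mem_supported']

/-- The differential `(f, g) ↦ (∂ f + φ g, - ∂ g)` of a mapping cone. -/
noncomputable def coneD (C E : ScalarComplex σ K) (φ : (E.B →₀ K) →ₗ[K] (C.B →₀ K)) :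
    (C.B ⊕ E.B →₀ K) →ₗ[K] (C.B ⊕ E.B →₀ K) :=
  (Finsupp.sumFinsuppLEquivProdFinsupp K).symm.toLinearMap ∘ₗ
    ((C.D ∘ₗ LinearMap.fst K _ _ + φ ∘ₗ LinearMap.snd K _ _).prod
      (-(E.D ∘ₗ LinearMap.snd K _ _))) ∘ₗ
    (Finsupp.sumFinsuppLEquivProdFinsupp K).toLinearMap

theorem coneD_symm (C E : ScalarComplex σ K) (φ : (E.B →₀ K) →ₗ[K] (C.B →₀ K))
    (f : C.B →₀ K) (g : E.B →₀ K) :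
    coneD C E φ ((Finsupp.sumFinsuppLEquivProdFinsupp K).symm (f, g)) =
      (Finsupp.sumFinsuppLEquivProdFinsupp K).symm (C.D f + φ g, -E.D g) := by
  simp [coneD]

/-- The mapping cone of a chain map `φ` from `E` to `C`. It is minimal if no multidegree occurs
in both `C` and `E`. -/
noncomputable def cone (C E : ScalarComplex σ K) (φ : (E.B →₀ K) →ₗ[K] (C.B →₀ K))
    (hφ : ∀ b, φ (Finsupp.single b 1) ∈ C.strand (E.hdeg b) (E.deg b))
    (hne : ∀ a b, C.deg a ≠ E.deg b) : ScalarComplex σ K where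
  B := C.B ⊕ E.B
  hdeg := Sum.elim C.hdeg (fun b => E.hdeg b + 1)
  deg := Sum.elim C.deg E.deg
  D := coneD C E φ
  ε := C.ε ∘ₗ LinearMap.fst K _ _ ∘ₗ (Finsupp.sumFinsuppLEquivProdFinsupp K).toLinearMap
  D_mem := by
    rintro (b | b)
    · have : Finsupp.single (Sum.inl b : C.B ⊕ E.B) (1 : K) =
          (Finsupp.sumFinsuppLEquivProdFinsupp K).symm (Finsupp.single b 1, 0) := by
        ext (a | a) <;> simp
      rw [this, coneD_symm, mem_supported_sum_iff]
      simpa using C.D_mem b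
    · have : Finsupp.single (Sum.inr b : C.B ⊕ E.B) (1 : K) =
          (Finsupp.sumFinsuppLEquivProdFinsupp K).symm (0, Finsupp.single b 1) := by
        ext (a | a) <;> simp
      rw [this, coneD_symm, mem_supported_sum_iff]
      simp only [LinearEquiv.apply_symm_apply, map_zero, zero_add]
      refine ⟨Finsupp.supported_mono (fun a ha => ?_) (hφ b), Submodule.neg_mem _
        (Finsupp.supported_mono (fun a ha => ?_) (E.D_mem b))⟩
      · exact ⟨congrArg (· + 1) ha.1, lt_of_le_of_ne ha.2 (hne a b)⟩
      · exact ⟨congrArg (· + 1) ha.1, ha.2⟩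

variable {C E : ScalarComplex σ K} {φ : (E.B →₀ K) →ₗ[K] (C.B →₀ K)}
  {hφ : ∀ b, φ (Finsupp.single b 1) ∈ C.strand (E.hdeg b) (E.deg b)}
  {hne : ∀ a b, C.deg a ≠ E.deg b}

theorem mem_strand_cone_succ {n : ℕ} {l : σ →₀ ℕ} {f : C.B →₀ K} {g : E.B →₀ K} :
    (Finsupp.sumFinsuppLEquivProdFinsupp K).symm (f, g) ∈ (cone C E φ hφ hne).strand (n + 1) l ↔
      f ∈ C.strand (n + 1) l ∧ g ∈ E.strand n l := by
  unfold strand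
  refine mem_supported_sum_iff.trans ?_
  simp [cone]

theorem mem_strand_cone_zero {l : σ →₀ ℕ} {f : C.B →₀ K} {g : E.B →₀ K} :
    (Finsupp.sumFinsuppLEquivProdFinsupp K).symm (f, g) ∈ (cone C E φ hφ hne).strand 0 l ↔
      f ∈ C.strand 0 l ∧ g = 0 := by
  unfold strand
  refine mem_supported_sum_iff.trans ?_
  simp [cone]

theorem exists_pair (v : C.B ⊕ E.B →₀ K) :
    ∃ f g, v = (Finsupp.sumFinsuppLEquivProdFinsupp K).symm (f, g) :=
  ⟨_, _, ((Finsupp.sumFinsuppLEquivProdFinsupp K).symm_apply_apply v).symm⟩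

theorem cone_ε (f : C.B →₀ K) (g : E.B →₀ K) : (cone C E φ hφ hne).ε
    ((Finsupp.sumFinsuppLEquivProdFinsupp K).symm (f, g)) = C.ε f := by
  change C.ε (Finsupp.sumFinsuppLEquivProdFinsupp K
    ((Finsupp.sumFinsuppLEquivProdFinsupp K).symm (f, g))).1 = C.ε f
  rw [LinearEquiv.apply_symm_apply]

theorem cone_D (f : C.B →₀ K) (g : E.B →₀ K) : (cone C E φ hφ hne).D
    ((Finsupp.sumFinsuppLEquivProdFinsupp K).symm (f, g)) =
      (Finsupp.sumFinsuppLEquivProdFinsupp K).symm (C.D f + φ g, -E.D g) :=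
  coneD_symm C E φ f g

/-- Let `C` resolve `S/M`, let `E` resolve the ideal of `S/M` generated by the monomial `d`, and let
`φ` be a chain map from `E` to `C` which lifts the inclusion. Its mapping cone
resolves `S/(M + (d))`. -/
theorem isResolution_cone {I : Set (σ →₀ ℕ)} {d : σ →₀ ℕ}
    (hI : IsUpperSet I) (hC : C.IsResolution I) (hE : E.IsShiftedResolution d I)
    (hφD : ∀ b, C.D (φ (Finsupp.single b 1)) = φ (E.D (Finsupp.single b 1)))
    (hφε : ∀ b, E.hdeg b = 0 →
      E.deg b ∈ I ∨ C.ε (φ (Finsupp.single b 1)) = E.ε (Finsupp.single b 1)) :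
    (cone C E φ hφ hne).IsResolution (I ∪ Set.Ici d) := by
  have hφDv : ∀ v, C.D (φ v) = φ (E.D v) := fun v =>
    map_eq_of_mem_supported (f := C.D ∘ₗ φ) (g := φ ∘ₗ E.D) (s := Set.univ)
      (fun b _ => hφD b) (by simp)
  have hφs : ∀ {n l v}, v ∈ E.strand n l → φ v ∈ C.strand n l := fun hv =>
    map_mem_of_mem_supported (fun b hb => C.strand_mono _ hb.2 (hb.1 ▸ hφ b)) hv
  have hφεv : ∀ {l v}, l ∉ I → v ∈ E.strand 0 l → C.ε (φ v) = E.ε v := fun hl hv =>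
    map_eq_of_mem_supported (f := C.ε ∘ₗ φ)
      (fun b hb => (hφε b hb.1).resolve_left fun h => hl (hI hb.2 h)) hv
  have hDD : ∀ v : C.B ⊕ E.B →₀ K,
      (cone C E φ hφ hne).D ((cone C E φ hφ hne).D v) = 0 := by
    intro v
    obtain ⟨f, g, rfl⟩ := exists_pair v
    rw [cone_D, cone_D, map_neg, map_neg, map_add, hφDv, hC.D_D_apply, hE.D_D,
      zero_add, add_neg_cancel, neg_zero, neg_zero]
    exact map_zero (Finsupp.sumFinsuppLEquivProdFinsupp K).symm
  have hεD : ∀ l, l ∉ I ∪ Set.Ici d → ∀ v : C.B ⊕ E.B →₀ K,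
      v ∈ (cone C E φ hφ hne).strand 1 l →
      (cone C E φ hφ hne).ε ((cone C E φ hφ hne).D v) = 0 := by
    intro l hl v hv
    simp only [Set.mem_union, Set.mem_Ici, not_or] at hl
    obtain ⟨f, g, rfl⟩ := exists_pair v
    rw [mem_strand_cone_succ (n := 0)] at hv
    rw [cone_D, cone_ε, eq_zero_of_mem_strand hE.le_deg hl.2 hv.2, map_zero, add_zero]
    exact hC.ε_D_apply hI hl.1 hv.1
  refine ⟨?_, fun b => hDD _, ?_, ?_, ?_, ?_⟩
  · intro n
    have h1 := (hC.finite n).image (Sum.inl : _ → C.B ⊕ E.B)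
    have h2 := (hE.finite (n - 1)).image (Sum.inr : _ → C.B ⊕ E.B)
    refine (h1.union h2).subset ?_
    rintro (b | b) hb
    · exact Or.inl ⟨b, hb, rfl⟩
    · have hb' : E.hdeg b + 1 = n := hb
      exact Or.inr ⟨b, Nat.eq_sub_of_add_eq hb', rfl⟩
  · intro b hb
    rw [or_iff_not_imp_left]
    exact fun hbI => hεD _ hbI _ (single_mem_strand hb le_rfl 1)
  · intro n l v hv h0
    obtain ⟨f, g, rfl⟩ := exists_pair v
    replace hv := mem_strand_cone_succ.1 hv
    have h0' : C.D f + φ g = 0 ∧ E.D g = 0 := by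
      have : (C.D f + φ g, -E.D g) = 0 :=
        (LinearEquiv.map_eq_zero_iff _).1 ((cone_D (hφ := hφ) (hne := hne) f g).symm.trans h0)
      rwa [Prod.mk_eq_zero, neg_eq_zero] at this
    obtain ⟨g', hg', hDg⟩ : ∃ g' ∈ E.strand (n + 1) l, E.D g' = g := by
      rcases n with _ | n
      · refine hE.exact_zero _ _ hv.2 ?_
        by_cases hl : l ∈ I
        · exact Or.inl hl
        · right
          have h1 := hC.ε_D_apply hI hl hv.1
          rwa [eq_neg_of_add_eq_zero_left h0'.1, map_neg, neg_eq_zero, hφεv hl hv.2] at h1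
      · exact hE.exact_succ _ _ _ hv.2 h0'.2
    obtain ⟨f', hf', hDf⟩ := hC.exact_succ n l (f + φ g')
      (Submodule.add_mem _ hv.1 (hφs hg')) (by rw [map_add, hφDv, hDg, h0'.1])
    refine ⟨(Finsupp.sumFinsuppLEquivProdFinsupp K).symm (f', -g'),
      mem_strand_cone_succ.2 ⟨hf', Submodule.neg_mem _ hg'⟩, ?_⟩
    refine (cone_D _ _).trans ?_
    rw [hDf, map_neg, map_neg, hDg, neg_neg, add_neg_cancel_right]
  · intro l v hv h0
    obtain ⟨f, g, rfl⟩ := exists_pair v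
    obtain ⟨hf, rfl⟩ := mem_strand_cone_zero.1 hv
    replace h0 := h0.imp_right (cone_ε (hφ := hφ) (hne := hne) f 0).symm.trans
    obtain ⟨g, hg, hfg⟩ : ∃ g ∈ E.strand 0 l, l ∈ I ∨ C.ε (f - φ g) = 0 := by
      by_cases hl : l ∈ I
      · exact ⟨0, Submodule.zero_mem _, Or.inl hl⟩
      by_cases hd : d ≤ l
      · obtain ⟨g, hg, hg1⟩ := hE.surjective l hl hd
        have hg' := Submodule.smul_mem _ (C.ε f) hg
        refine ⟨C.ε f • g, hg', Or.inr ?_⟩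
        rw [map_sub, hφεv hl hg']
        simp [hg1]
      · exact ⟨0, Submodule.zero_mem _, Or.inr (by simpa [hl, hd] using h0)⟩
    obtain ⟨f', hf', hDf⟩ := hC.exact_zero l (f - φ g) (Submodule.sub_mem _ hf (hφs hg)) hfg
    refine ⟨(Finsupp.sumFinsuppLEquivProdFinsupp K).symm (f', g),
      mem_strand_cone_succ (n := 0).2 ⟨hf', hg⟩, ?_⟩
    refine (cone_D _ _).trans ?_
    rw [hDf, D_eq_zero hg, sub_add_cancel, neg_zero]
  · intro l hl
    simp only [Set.mem_union, not_or] at hl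
    obtain ⟨v, hv, hv1⟩ := hC.surjective l hl.1
    exact ⟨(Finsupp.sumFinsuppLEquivProdFinsupp K).symm (v, 0),
      mem_strand_cone_zero.2 ⟨hv, rfl⟩, (cone_ε _ _).trans hv1⟩

/-- If `C` and `G` are minimal resolutions of `S/M` and `S/(M : d)`, and `d` divides no multidegree
of `C`, then there is a minimal resolution of `S/(M + (d))` whose basis consists of the bases of `C`
and of the shift of `G`, the latter with homological degrees raised by one. -/
theorem exists_isResolution_union {G : ScalarComplex σ K} {I : Set (σ →₀ ℕ)} {d : σ →₀ ℕ}
    (hI : IsUpperSet I) (hC : C.IsResolution I) (hG : G.IsResolution {l | l + d ∈ I})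
    (hd : ∀ b, ¬ d ≤ C.deg b) :
    ∃ F : ScalarComplex σ K, F.IsResolution (I ∪ Set.Ici d) ∧ ∃ e : C.B ⊕ G.B ≃ F.B,
      (∀ b, F.hdeg (e (Sum.inl b)) = C.hdeg b ∧ F.deg (e (Sum.inl b)) = C.deg b) ∧
      ∀ b, F.hdeg (e (Sum.inr b)) = G.hdeg b + 1 ∧ F.deg (e (Sum.inr b)) = G.deg b + d := by
  obtain ⟨φ, hφ, hφD, hφε⟩ := exists_chainMap (C := G.shift d) hG.D_D hG.ε_D hI hC
  have hne : ∀ a b, C.deg a ≠ (G.shift d).deg b := fun a b h => hd a (h ▸ le_add_self)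
  exact ⟨cone C (G.shift d) φ hφ hne, isResolution_cone hI hC hG.shift hφD hφε,
    Equiv.refl _, fun b => ⟨rfl, rfl⟩, fun b => ⟨rfl, rfl⟩⟩

end ScalarComplex

/-! ### Existence of minimal resolutions -/

section Existence

universe u v

variable {σ : Type u} {K : Type v} [Field K]

/-- The vectors supported on the basis elements whose multidegree divides `l`. -/
def below {ι : Type*} (deg : ι → σ →₀ ℕ) (l : σ →₀ ℕ) : Submodule K (ι → K) where
  carrier := {u | ∀ a, u a ≠ 0 → deg a ≤ l}
  zero_mem' := fun _ h => absurd rfl h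
  add_mem' := by
    intro u v hu hv a h
    by_cases hua : u a = 0
    · exact hv a fun hva => h (by simp [hua, hva])
    · exact hu a hua
  smul_mem' := fun r u hu a h => hu a (right_ne_zero_of_mul (a := r) h)

theorem mem_below {ι : Type*} {deg : ι → σ →₀ ℕ} {l : σ →₀ ℕ} {u : ι → K} :
    u ∈ below deg l ↔ ∀ a, u a ≠ 0 → deg a ≤ l := Iff.rfl

theorem below_mono {ι : Type*} (deg : ι → σ →₀ ℕ) :
    Monotone (below deg : (σ →₀ ℕ) → Submodule K (ι → K)) :=
  fun _ _ h _ hu => mem_below.2 fun a ha => (mem_below.1 hu a ha).trans h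

/-- A family of subspaces `N l`, increasing in the multidegree `l` and determined by its values
below `L`, has a finite minimal system of generators. It is obtained by choosing, for each `l ≤ L`,
a basis of a complement of `⨆ l' < l, N l'` in `N l`. -/
theorem exists_fintype_minimal_generators {ι : Type*} [Finite ι] (deg : ι → σ →₀ ℕ) (L : σ →₀ ℕ)
    (N : (σ →₀ ℕ) → Submodule K (ι → K)) (hmono : Monotone N) (hL : ∀ l, N l = N (l ⊓ L))
    (hbelow : ∀ l, N l ≤ below deg l) (hmin : ∀ l, ∀ v ∈ N l, ∀ a, deg a = l → v a = 0) :
    ∃ (J : Type u) (_ : Fintype J) (deg' : J → σ →₀ ℕ) (c : Matrix ι J K),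
      (∀ b, deg' b ≤ L) ∧ (∀ a b, c a b ≠ 0 → deg a < deg' b) ∧
      (∀ l v, v ∈ N l ↔ ∃ w ∈ below deg' l, c.mulVec w = v) ∧
      ∀ l, ∀ w ∈ below deg' l, c.mulVec w = 0 → ∀ b, deg' b = l → w b = 0 := by
  classical
  have hQ : ∀ l, ∃ Q : Submodule K (ι → K),
      Disjoint (⨆ l' < l, N l') Q ∧ (⨆ l' < l, N l') ⊔ Q = N l := fun l =>
    IsModularLattice.exists_disjoint_and_sup_eq (iSup₂_le fun l' h => hmono h.le)
  choose Q hdisj hsup using hQ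
  have hQN : ∀ l, Q l ≤ N l := fun l => hsup l ▸ le_sup_right
  have : Fintype (Set.Iic L) := (Set.finite_Iic L).fintype
  let J := Σ l : Set.Iic L, Fin (Module.finrank K (Q l))
  let g : J → ι → K := fun j => (Module.finBasis K (Q j.1) j.2 : ι → K)
  have hg : ∀ j, g j ∈ Q j.1 := fun j => (Module.finBasis K (Q j.1) j.2).2
  let deg' : J → σ →₀ ℕ := fun j => j.1
  let c : Matrix ι J K := Matrix.of fun a j => g j a
  have hc : ∀ w : J → K, c.mulVec w = ∑ j, w j • g j := by
    intro w
    ext a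
    simp [c, Matrix.mulVec, dotProduct, mul_comm]
  have hcN : ∀ l, ∀ w ∈ below deg' l, c.mulVec w ∈ N l := by
    intro l w hw
    rw [hc]
    refine Submodule.sum_mem _ fun j _ => ?_
    by_cases hj : w j = 0
    · simp [hj]
    · exact Submodule.smul_mem _ _ (hmono (mem_below.1 hw j hj) (hQN _ (hg j)))
  have hgen : ∀ l, N l ≤ (below deg' l).map c.mulVecLin := by
    intro l
    induction l using WellFoundedLT.induction with
    | ind l ih =>
      rcases (inf_le_left : l ⊓ L ≤ l).eq_or_lt with h | h
      · have hlL : l ≤ L := inf_eq_left.1 h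
        rw [← hsup l]
        refine sup_le (iSup₂_le fun l' h' => (ih l' h').trans
          (Submodule.map_mono (below_mono _ h'.le))) fun v hv => ?_
        let w : J → K := fun j =>
          if h : (j.1 : σ →₀ ℕ) = l then
            (Module.finBasis K (Q l)).repr ⟨v, hv⟩ (Fin.cast (by rw [h]) j.2) else 0
        refine ⟨w, ?_, ?_⟩
        · refine mem_below.2 fun j hj => ?_
          by_contra hne
          exact hj (dif_neg fun h => hne h.le)
        · rw [Matrix.mulVecLin_apply, hc, Fintype.sum_sigma,
            Finset.sum_eq_single (⟨l, hlL⟩ : Set.Iic L)]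
          · have := congrArg (Q l).subtype ((Module.finBasis K (Q l)).sum_repr ⟨v, hv⟩)
            rw [map_sum] at this
            simpa only [w, g, map_smul, Submodule.subtype_apply, dif_pos, Fin.cast_eq_self]
              using this
          · intro l' _ hl'
            refine Finset.sum_eq_zero fun i _ => ?_
            have : (l' : σ →₀ ℕ) ≠ l := fun h => hl' (Subtype.ext h)
            simp [w, this]
          · simp
      · rw [hL l]
        exact (ih _ h).trans (Submodule.map_mono (below_mono _ h.le))
  refine ⟨J, inferInstance, deg', c, fun b => b.1.2, ?_, ?_, ?_⟩
  · intro a b hab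
    refine lt_of_le_of_ne (mem_below.1 (hbelow _ (hQN _ (hg b))) a hab) fun h => hab ?_
    exact hmin _ _ (hQN _ (hg b)) a h
  · intro l v
    constructor
    · intro hv
      obtain ⟨w, hw, h⟩ := hgen l hv
      exact ⟨w, hw, h⟩
    · rintro ⟨w, hw, rfl⟩
      exact hcN l w hw
  · rintro l w hw h0 ⟨⟨l', hl'⟩, i⟩ rfl
    change w ∈ below deg' l' at hw
    rw [hc, Fintype.sum_sigma,
      ← Finset.add_sum_erase _ _ (Finset.mem_univ (⟨l', hl'⟩ : Set.Iic L))] at h0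
    have h1 : ∑ i, w ⟨⟨l', hl'⟩, i⟩ • g ⟨⟨l', hl'⟩, i⟩ ∈ Q l' :=
      Submodule.sum_mem _ fun i _ => Submodule.smul_mem _ _ (hg ⟨⟨l', hl'⟩, i⟩)
    have h2 : ∑ x ∈ Finset.univ.erase (⟨l', hl'⟩ : Set.Iic L), ∑ i, w ⟨x, i⟩ • g ⟨x, i⟩ ∈
        ⨆ m < l', N m := by
      refine Submodule.sum_mem _ fun x hx => Submodule.sum_mem _ fun i _ => ?_
      by_cases hj : w ⟨x, i⟩ = 0
      · simp [hj]
      · have hlt : (x : σ →₀ ℕ) < l' :=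
          lt_of_le_of_ne (mem_below.1 hw ⟨x, i⟩ hj) fun h =>
            (Finset.mem_erase.1 hx).1 (Subtype.ext h)
        exact Submodule.smul_mem _ _
          ((le_iSup₂_of_le (x : σ →₀ ℕ) hlt le_rfl : N x ≤ _) (hQN _ (hg ⟨x, i⟩)))
    have h3 : ∑ i, w ⟨⟨l', hl'⟩, i⟩ • g ⟨⟨l', hl'⟩, i⟩ = 0 :=
      Submodule.disjoint_def.1 (hdisj l') _
        (by rw [eq_neg_of_add_eq_zero_left h0]; exact Submodule.neg_mem _ h2) h1
    have h4 : ∑ i, w ⟨⟨l', hl'⟩, i⟩ • Module.finBasis K (Q l') i = 0 := by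
      apply Subtype.ext
      simpa [g] using h3
    exact Fintype.linearIndependent_iff.1 (Module.finBasis K (Q l')).linearIndependent _ h4 i

theorem exists_minimal_generators {ι : Type*} [Finite ι] (deg : ι → σ →₀ ℕ) (L : σ →₀ ℕ)
    (N : (σ →₀ ℕ) → Submodule K (ι → K)) (hmono : Monotone N) (hL : ∀ l, N l = N (l ⊓ L))
    (hbelow : ∀ l, N l ≤ below deg l) (hmin : ∀ l, ∀ v ∈ N l, ∀ a, deg a = l → v a = 0) :
    ∃ (r : ℕ) (deg' : Fin r → σ →₀ ℕ) (c : Matrix ι (Fin r) K),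
      (∀ b, deg' b ≤ L) ∧ (∀ a b, c a b ≠ 0 → deg a < deg' b) ∧
      (∀ l v, v ∈ N l ↔ ∃ w ∈ below deg' l, c.mulVec w = v) ∧
      ∀ l, ∀ w ∈ below deg' l, c.mulVec w = 0 → ∀ b, deg' b = l → w b = 0 := by
  obtain ⟨J, _, deg', c, h1, h2, h3, h4⟩ :=
    exists_fintype_minimal_generators deg L N hmono hL hbelow hmin
  let e := (Fintype.equivFin J).symm
  have hmul : ∀ w, (c.submatrix id e).mulVec w = c.mulVec (w ∘ e.symm) := fun w =>
    Matrix.submatrix_mulVec_equiv c w id e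
  refine ⟨Fintype.card J, deg' ∘ e, c.submatrix id e, fun b => h1 _, fun a b => h2 a (e b), ?_, ?_⟩
  · intro l v
    rw [h3]
    constructor
    · rintro ⟨w, hw, rfl⟩
      refine ⟨w ∘ e, mem_below.2 fun a ha => mem_below.1 hw _ ha, ?_⟩
      rw [hmul]
      congr 1
      ext a
      simp
    · rintro ⟨w, hw, rfl⟩
      exact ⟨w ∘ e.symm, mem_below.2 fun a ha => by simpa using mem_below.1 hw _ ha, (hmul w).symm⟩
  · intro l w hw h0 b hb
    have := h4 l (w ∘ e.symm) (mem_below.2 fun a ha => by simpa using mem_below.1 hw _ ha)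
      (by rw [← hmul, h0]) (e b) hb
    simpa using this

/-- A minimal multigraded free resolution of `S/M` in which only the scalars in the matrices of the
differentials are recorded; `I` is the set of exponents of the monomials in `M`. -/
structure MatrixResolution (K : Type v) [Field K] (I : Set (σ →₀ ℕ)) where
  rank : ℕ → ℕ
  deg : (i : ℕ) → Fin (rank i) → σ →₀ ℕ
  c : (i : ℕ) → Matrix (Fin (rank i)) (Fin (rank (i + 1))) K
  e : Fin (rank 0) → K
  lt : ∀ i a b, c i a b ≠ 0 → deg i a < deg (i + 1) b
  exact_succ : ∀ i l, ∀ v ∈ below (deg (i + 1)) l,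
    (c i).mulVec v = 0 ↔ ∃ w ∈ below (deg (i + 2)) l, (c (i + 1)).mulVec w = v
  exact_zero : ∀ l, ∀ v ∈ below (deg 0) l,
    (l ∈ I ∨ e ⬝ᵥ v = 0) ↔ ∃ w ∈ below (deg 1) l, (c 0).mulVec w = v
  surjective : ∀ l ∉ I, ∃ v ∈ below (deg 0) l, e ⬝ᵥ v = 1

/-- A free module with the components `N l` of a multigraded submodule of it which is contained in
the multiple of the free module by the homogeneous maximal ideal. The multidegrees of the basis
elements divide `L`, and `N l` depends only on the greatest common divisor of `l` and `L`. -/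
structure SyzygyStage (K : Type v) [Field K] (L : σ →₀ ℕ) where
  r : ℕ
  deg : Fin r → σ →₀ ℕ
  N : (σ →₀ ℕ) → Submodule K (Fin r → K)
  deg_le : ∀ a, deg a ≤ L
  mono : Monotone N
  eq_inf : ∀ l, N l = N (l ⊓ L)
  le_below : ∀ l, N l ≤ below deg l
  minimal : ∀ l, ∀ v ∈ N l, ∀ a, deg a = l → v a = 0

theorem below_inf {ι : Type*} {deg : ι → σ →₀ ℕ} {L : σ →₀ ℕ} (h : ∀ a, deg a ≤ L) (l : σ →₀ ℕ) :
    (below deg l : Submodule K (ι → K)) = below deg (l ⊓ L) := by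
  ext u
  simp [mem_below, h]

theorem SyzygyStage.exists_next {L : σ →₀ ℕ} (s : SyzygyStage K L) :
    ∃ (t : SyzygyStage K L) (c : Matrix (Fin s.r) (Fin t.r) K),
      (∀ a b, c a b ≠ 0 → s.deg a < t.deg b) ∧
      (∀ l v, v ∈ s.N l ↔ ∃ w ∈ below t.deg l, c.mulVec w = v) ∧
      ∀ l v, v ∈ t.N l ↔ v ∈ below t.deg l ∧ c.mulVec v = 0 := by
  obtain ⟨r, deg, c, h1, h2, h3, h4⟩ :=
    exists_minimal_generators s.deg L s.N s.mono s.eq_inf s.le_below s.minimal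
  refine ⟨⟨r, deg, fun l => below deg l ⊓ LinearMap.ker c.mulVecLin, h1, ?_, ?_, ?_, ?_⟩,
    c, h2, h3, ?_⟩
  · exact fun l l' h => inf_le_inf_right _ (below_mono _ h)
  · intro l
    rw [below_inf h1 l]
  · exact fun l => inf_le_left
  · exact fun l v hv => h4 l v hv.1 (by simpa using hv.2)
  · simp

/-- The minimal resolution is built by taking minimal generators of the successive syzygies. -/
theorem exists_matrixResolution {I : Set (σ →₀ ℕ)} (hI : IsUpperSet I) {L : σ →₀ ℕ}
    (hL : ∀ l, l ∈ I ↔ l ⊓ L ∈ I) :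
    ∃ F : MatrixResolution K I, ∀ i a, F.deg i a ≤ L := by
  classical
  -- the module in degree zero is `S`, or zero if `S/M` is zero
  obtain ⟨r₀, hr₀, hr₁⟩ : ∃ r : ℕ, ((0 : σ →₀ ℕ) ∈ I → r = 0) ∧ ((0 : σ →₀ ℕ) ∉ I → r = 1) := by
    by_cases h : (0 : σ →₀ ℕ) ∈ I
    · exact ⟨0, by simp [h]⟩
    · exact ⟨1, by simp [h]⟩
  let s₀ : SyzygyStage K L :=
    { r := r₀
      deg := fun _ => 0
      N := fun l =>
        { carrier := {v | l ∈ I ∨ ∑ a, v a = 0}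
          zero_mem' := by simp
          add_mem' := by
            rintro u v (hu | hu) (hv | hv)
            · exact Or.inl hu
            · exact Or.inl hu
            · exact Or.inl hv
            · right
              simp only [Pi.add_apply, Finset.sum_add_distrib, hu, hv, add_zero]
          smul_mem' := by
            rintro c u (hu | hu)
            · exact Or.inl hu
            · right
              simp [← Finset.mul_sum, hu] }
      deg_le := fun _ => by simp
      mono := fun l l' h v hv => hv.imp_left (hI h)
      eq_inf := fun l => by
        ext v
        exact or_congr_left (hL l)
      le_below := fun l v _ => mem_below.2 fun a _ => by simp
      minimal := fun l v hv a ha => by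
        by_cases h0 : (0 : σ →₀ ℕ) ∈ I
        · have : r₀ = 0 := hr₀ h0
          exact absurd a.2 (by omega)
        · have hr : r₀ = 1 := hr₁ h0
          have hv' := hv.resolve_left (ha ▸ h0)
          have : ∀ (n : ℕ) (hn : n = 1) (v : Fin n → K), ∑ a, v a = 0 → ∀ a, v a = 0 := by
            rintro _ rfl v hv a
            simpa [Subsingleton.elim a 0] using hv
          exact this _ hr v hv' a }
  -- each stage consists of a module of the resolution and the kernel of the map leaving it
  choose nx c h1 h2 h3 using fun s : SyzygyStage K L => s.exists_next
  let S : ℕ → SyzygyStage K L := fun n => Nat.rec s₀ (fun _ s => nx s) n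
  refine ⟨⟨fun i => (S i).r, fun i => (S i).deg, fun i => c (S i), fun _ => 1,
    fun i => h1 (S i), ?_, ?_, ?_⟩, fun i => (S i).deg_le⟩
  · intro i l v hv
    rw [← h2 (S (i + 1))]
    exact ⟨fun h => (h3 (S i) l v).2 ⟨hv, h⟩, fun h => ((h3 (S i) l v).1 h).2⟩
  · intro l v hv
    refine Iff.trans ?_ (h2 (S 0) l v)
    refine or_congr_right ?_
    simp only [dotProduct, one_mul]
    exact Iff.rfl
  · intro l hl
    have h0 : (0 : σ →₀ ℕ) ∉ I := fun h => hl (hI (by simp) h)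
    have hr : r₀ = 1 := hr₁ h0
    refine ⟨fun _ => 1, mem_below.2 fun a _ => ?_, ?_⟩
    · change (0 : σ →₀ ℕ) ≤ l
      simp
    · have : (S 0).r = 1 := hr
      simp [dotProduct, this]

end Existence

/-! ### Multigraded components of free modules -/

section Component

universe u v

variable {σ : Type u} {K : Type v} [Field K]

/-- The component in multidegree `l` of an element of a free module with basis elements of
multidegrees `deg`: the entry at the basis element `a` is the coefficient of the monomial
`l / deg a`. -/
noncomputable def component {ι : Type*} (deg : ι → σ →₀ ℕ) (l : σ →₀ ℕ)
    (v : ι → MvPolynomial σ K) : ι → K :=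
  fun a => coeff l (monomial (deg a) 1 * v a)

theorem component_mem_below {ι : Type*} (deg : ι → σ →₀ ℕ) (l : σ →₀ ℕ)
    (v : ι → MvPolynomial σ K) : component deg l v ∈ below deg l := by
  refine mem_below.2 fun a ha => ?_
  by_contra h
  exact ha (by simp [component, coeff_monomial_mul', h])

theorem component_ext {ι : Type*} {deg : ι → σ →₀ ℕ} {v w : ι → MvPolynomial σ K}
    (h : ∀ l, component deg l v = component deg l w) : v = w := by
  ext a s
  simpa [component, coeff_monomial_mul] using congrFun (h (deg a + s)) a

theorem finite_component_ne_zero {ι : Type*} [Finite ι] (deg : ι → σ →₀ ℕ)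
    (v : ι → MvPolynomial σ K) : {l | component deg l v ≠ 0}.Finite := by
  refine (Set.finite_iUnion fun a : ι =>
    (monomial (deg a) (1 : K) * v a).support.finite_toSet).subset fun l hl => ?_
  obtain ⟨a, ha⟩ := Function.ne_iff.1 hl
  exact Set.mem_iUnion.2 ⟨a, by simpa [component] using ha⟩

theorem single_mem_below {ι : Type*} {deg : ι → σ →₀ ℕ} {l : σ →₀ ℕ} {u : ι → K}
    (hu : u ∈ below deg l) (l' : σ →₀ ℕ) : Finsupp.single l u l' ∈ below deg l' := by
  classical
  rw [Finsupp.single_apply]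
  split_ifs with h
  · exact h ▸ hu
  · exact Submodule.zero_mem _

/-- Vectors in finitely many multidegrees are the components of an element of the free module. -/
theorem exists_component_eq {ι : Type*} (deg : ι → σ →₀ ℕ) (u : (σ →₀ ℕ) →₀ (ι → K))
    (hu : ∀ l, u l ∈ below deg l) : ∃ v : ι → MvPolynomial σ K, ∀ l, component deg l v = u l := by
  classical
  refine ⟨fun a => ∑ l ∈ u.support, monomial (l - deg a) (u l a), fun l => ?_⟩
  ext a
  have h : ∀ m, monomial (deg a) (1 : K) * monomial (m - deg a) (u m a) = monomial m (u m a) := by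
    intro m
    by_cases hm : u m a = 0
    · simp [hm]
    · rw [monomial_mul, one_mul, add_tsub_cancel_of_le (mem_below.1 (hu m) a hm)]
  simp only [component, Finset.mul_sum, h, coeff_sum, coeff_monomial]
  rw [Finset.sum_ite_eq']
  split_ifs with hl
  · rfl
  · rw [Finsupp.notMem_support_iff.1 hl, Pi.zero_apply]

/-- The components of the image under a multigraded map are the images of the components under the
scalar matrix of the map. -/
theorem component_mulVec {ι κ : Type*} [Fintype κ] {deg : ι → σ →₀ ℕ} {deg' : κ → σ →₀ ℕ}
    {A : Matrix ι κ (MvPolynomial σ K)} {c : Matrix ι κ K}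
    (h : ∀ a b, monomial (deg a) 1 * A a b = monomial (deg' b) (c a b)) (l : σ →₀ ℕ)
    (v : κ → MvPolynomial σ K) :
    component deg l (A.mulVec v) = c.mulVec (component deg' l v) := by
  ext a
  simp only [component, Matrix.mulVec, dotProduct, Finset.mul_sum, coeff_sum]
  refine Finset.sum_congr rfl fun b _ => ?_
  rw [← mul_assoc, h, ← coeff_C_mul, ← mul_assoc, C_mul_monomial, mul_one]

/-- Exactness of multigraded maps of free modules can be checked in each multidegree. -/
theorem exact_iff_component {ι κ : Type*} [Finite ι] [Fintype κ] {deg : ι → σ →₀ ℕ}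
    {deg' : κ → σ →₀ ℕ} {A : Matrix ι κ (MvPolynomial σ K)} {c : Matrix ι κ K}
    (h : ∀ a b, monomial (deg a) 1 * A a b = monomial (deg' b) (c a b))
    {Z : (ι → MvPolynomial σ K) → Prop} {z : (σ →₀ ℕ) → (ι → K) → Prop}
    (hZ : ∀ v, Z v ↔ ∀ l, z l (component deg l v)) (hz : ∀ l, z l 0) :
    (∀ v, Z v ↔ ∃ w, A.mulVec w = v) ↔
      ∀ l, ∀ u ∈ below deg l, z l u ↔ ∃ w ∈ below deg' l, c.mulVec w = u := by
  classical
  constructor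
  · intro hex l u hu
    obtain ⟨V, hV⟩ := exists_component_eq deg (Finsupp.single l u) (single_mem_below hu)
    have h1 : Z V ↔ z l u := by
      rw [hZ]
      refine ⟨fun h => by simpa [hV] using h l, fun h l' => ?_⟩
      rw [hV]
      by_cases hl : l = l'
      · subst hl
        simpa using h
      · rw [Finsupp.single_eq_of_ne (Ne.symm hl)]
        exact hz l'
    rw [← h1, hex]
    constructor
    · rintro ⟨W, hW⟩
      exact ⟨component deg' l W, component_mem_below _ _ _,
        by rw [← component_mulVec h, hW, hV, Finsupp.single_eq_same]⟩
    · rintro ⟨w, hw, hwu⟩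
      obtain ⟨W, hW⟩ := exists_component_eq deg' (Finsupp.single l w) (single_mem_below hw)
      refine ⟨W, component_ext (deg := deg) fun l' => ?_⟩
      rw [component_mulVec h, hW, hV]
      by_cases hl : l = l'
      · subst hl
        simpa using hwu
      · rw [Finsupp.single_eq_of_ne (Ne.symm hl), Finsupp.single_eq_of_ne (Ne.symm hl),
          Matrix.mulVec_zero]
  · intro hex v
    rw [hZ]
    constructor
    · intro hv
      have : ∀ l, ∃ w ∈ below deg' l, c.mulVec w = component deg l v ∧
          (w ≠ 0 → component deg l v ≠ 0) := by
        intro l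
        by_cases h0 : component deg l v = 0
        · exact ⟨0, Submodule.zero_mem _, by simp [h0], by simp⟩
        · obtain ⟨w, hw, hwv⟩ := (hex l _ (component_mem_below _ _ _)).1 (hv l)
          exact ⟨w, hw, hwv, fun _ => h0⟩
      choose w hw hwv hw0 using this
      obtain ⟨W, hW⟩ := exists_component_eq deg'
        (Finsupp.onFinset (finite_component_ne_zero deg v).toFinset w
          (fun l hl => by simpa using hw0 l hl)) hw
      refine ⟨W, component_ext (deg := deg) fun l => ?_⟩
      rw [component_mulVec h, hW]
      exact hwv l
    · rintro ⟨W, rfl⟩ l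
      rw [hex l _ (component_mem_below _ _ _)]
      exact ⟨_, component_mem_below _ _ _, (component_mulVec h l W).symm⟩

end Component

/-! ### Resolutions over the polynomial ring and over the field -/

section Translation

universe u v

variable {σ : Type u} {K : Type v} [Field K] {M : Ideal (MvPolynomial σ K)}

/-- The exponents of the monomials in `M`. -/
def exponents (M : Ideal (MvPolynomial σ K)) : Set (σ →₀ ℕ) :=
  {l | monomial l (1 : K) ∈ M}

theorem isUpperSet_exponents (M : Ideal (MvPolynomial σ K)) : IsUpperSet (exponents M) := by
  intro a b hab ha
  have : monomial b (1 : K) = monomial (b - a) 1 * monomial a 1 := by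
    rw [monomial_mul, one_mul, tsub_add_cancel_of_le hab]
  change monomial b (1 : K) ∈ M
  rw [this]
  exact M.mul_mem_left _ ha

theorem IsMonomialIdeal.mem_iff (hM : IsMonomialIdeal M) {p : MvPolynomial σ K} :
    p ∈ M ↔ ∀ l, l ∈ exponents M ∨ coeff l p = 0 := by
  classical
  obtain ⟨G, rfl⟩ := hM
  simp only [exponents, Set.mem_ofPred_eq, mem_ideal_span_monomial_image, mem_support_iff,
    coeff_monomial, ne_eq]
  refine forall_congr' fun l => ?_
  by_cases h : coeff l p = 0 <;> simp [h]

/-- The augmentation of a free module to `S`, sending the basis element `b` to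
`e b` times the monomial of exponent `deg b`. -/
noncomputable def augmentation {ι : Type*} [Fintype ι] (deg : ι → σ →₀ ℕ) (e : ι → K) :
    (ι → MvPolynomial σ K) →ₗ[MvPolynomial σ K] MvPolynomial σ K :=
  ∑ b, monomial (deg b) (e b) • LinearMap.proj b

theorem coeff_augmentation {ι : Type*} [Fintype ι] (deg : ι → σ →₀ ℕ) (e : ι → K) (l : σ →₀ ℕ)
    (v : ι → MvPolynomial σ K) : coeff l (augmentation deg e v) = e ⬝ᵥ component deg l v := by
  simp only [augmentation, LinearMap.sum_apply, LinearMap.smul_apply, LinearMap.proj_apply,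
    smul_eq_mul, coeff_sum, dotProduct, component]
  refine Finset.sum_congr rfl fun b _ => ?_
  rw [← coeff_C_mul, ← mul_assoc, C_mul_monomial, mul_one]

theorem augmentation_single {ι : Type*} [Fintype ι] [DecidableEq ι] (deg : ι → σ →₀ ℕ) (e : ι → K)
    (b : ι) : augmentation deg e (Pi.single b 1) = monomial (deg b) (e b) := by
  simp [augmentation, LinearMap.sum_apply, Pi.single_apply]

theorem mk_augmentation_eq_zero_iff (hM : IsMonomialIdeal M) {ι : Type*} [Fintype ι]
    (deg : ι → σ →₀ ℕ) (e : ι → K) (v : ι → MvPolynomial σ K) :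
    Ideal.Quotient.mk M (augmentation deg e v) = 0 ↔
      ∀ l, l ∈ exponents M ∨ e ⬝ᵥ component deg l v = 0 := by
  simp [Ideal.Quotient.eq_zero_iff_mem, hM.mem_iff, coeff_augmentation]

namespace MinimalFreeResolution

variable (F : MinimalFreeResolution M)

/-- The scalars in the matrix of a differential. -/
noncomputable def scalar (i : ℕ) : Matrix (Fin (F.rank i)) (Fin (F.rank (i + 1))) K :=
  Matrix.of fun a b => (F.d_homogeneous i a b).choose

theorem monomial_mul_toMatrix (i : ℕ) (a : Fin (F.rank i)) (b : Fin (F.rank (i + 1))) :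
    monomial (F.deg i a) (1 : K) * LinearMap.toMatrix' (F.d i) a b =
      monomial (F.deg (i + 1) b) (F.scalar i a b) := by
  rw [LinearMap.toMatrix'_apply]
  exact (F.d_homogeneous i a b).choose_spec

/-- The scalars in the matrix of the augmentation. -/
noncomputable def augScalar (b : Fin (F.rank 0)) : K :=
  (F.aug_homogeneous b).choose

theorem aug_eq (v : Fin (F.rank 0) → MvPolynomial σ K) :
    F.aug v = Ideal.Quotient.mk M (augmentation (F.deg 0) F.augScalar v) := by
  have : F.aug = M.mkQ ∘ₗ augmentation (F.deg 0) F.augScalar := by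
    refine LinearMap.pi_ext' fun b => LinearMap.ext_ring ?_
    simp only [LinearMap.comp_apply, LinearMap.single_apply, augmentation_single]
    exact (F.aug_homogeneous b).choose_spec
  rw [this]
  rfl

theorem deg_lt_deg {i : ℕ} {a : Fin (F.rank i)} {b : Fin (F.rank (i + 1))}
    (h : F.scalar i a b ≠ 0) : F.deg i a < F.deg (i + 1) b := by
  classical
  have h1 := F.monomial_mul_toMatrix i a b
  refine lt_of_le_of_ne ?_ fun heq => ?_
  · by_contra hle
    have := congrArg (coeff (F.deg (i + 1) b)) h1
    rw [coeff_monomial_mul', if_neg hle, coeff_monomial, if_pos rfl] at this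
    exact h this.symm
  · rw [← heq, ← mul_one (F.scalar i a b), ← C_mul_monomial, mul_comm (C _)] at h1
    have h2 := mul_left_cancel₀ (by simp) h1
    refine F.minimal i a b ?_
    rw [← LinearMap.toMatrix'_apply, h2]
    exact (IsUnit.mk0 _ h).map C

/-- The scalar matrices of a minimal multigraded free resolution. -/
noncomputable def toMatrixResolution (hM : IsMonomialIdeal M) :
    MatrixResolution K (exponents M) where
  rank := F.rank
  deg := F.deg
  c := F.scalar
  e := F.augScalar
  lt _ _ _ h := F.deg_lt_deg h
  exact_succ i := by
    refine (exact_iff_component (F.monomial_mul_toMatrix (i + 1)) (Z := fun v => F.d i v = 0)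
      (z := fun _ u => (F.scalar i).mulVec u = 0) ?_ ?_).1 ?_
    · intro v
      rw [← LinearMap.toMatrix'_mulVec]
      simp only [← component_mulVec (F.monomial_mul_toMatrix i)]
      refine ⟨fun h l => ?_, fun h => component_ext (deg := F.deg i) fun l => ?_⟩
      · rw [h]
        ext
        simp [component]
      · rw [h]
        ext
        simp [component]
    · simp
    · intro v
      simpa only [LinearMap.toMatrix'_mulVec, Set.mem_range] using F.exact_succ i v
  exact_zero := by
    refine (exact_iff_component (F.monomial_mul_toMatrix 0) (Z := fun v => F.aug v = 0)
      (z := fun l u => l ∈ exponents M ∨ F.augScalar ⬝ᵥ u = 0) ?_ ?_).1 ?_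
    · intro v
      rw [aug_eq, mk_augmentation_eq_zero_iff hM]
    · simp
    · intro v
      simpa only [LinearMap.toMatrix'_mulVec, Set.mem_range] using F.exact_zero v
  surjective l hl := by
    classical
    obtain ⟨v, hv⟩ := F.aug_surjective (Ideal.Quotient.mk M (monomial l 1))
    refine ⟨component (F.deg 0) l v, component_mem_below _ _ _, ?_⟩
    rw [aug_eq, ← sub_eq_zero, ← map_sub, Ideal.Quotient.eq_zero_iff_mem, hM.mem_iff] at hv
    have := (hv l).resolve_left hl
    simpa [coeff_augmentation, coeff_monomial, sub_eq_zero] using this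

end MinimalFreeResolution

/-- A minimal resolution given by scalar matrices comes from a minimal multigraded free
resolution. -/
theorem MatrixResolution.nonempty_minimalFreeResolution (hM : IsMonomialIdeal M)
    (F : MatrixResolution K (exponents M)) : Nonempty (MinimalFreeResolution M) := by
  classical
  let A : (i : ℕ) → Matrix (Fin (F.rank i)) (Fin (F.rank (i + 1))) (MvPolynomial σ K) := fun i =>
    Matrix.of fun a b => monomial (F.deg (i + 1) b - F.deg i a) (F.c i a b)
  have hA : ∀ i a b, monomial (F.deg i a) 1 * A i a b = monomial (F.deg (i + 1) b) (F.c i a b) := by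
    intro i a b
    by_cases h : F.c i a b = 0
    · simp [A, h]
    · simp only [A, Matrix.of_apply, monomial_mul, one_mul]
      rw [add_tsub_cancel_of_le (F.lt i a b h).le]
  refine ⟨⟨F.rank, F.deg, fun i => (A i).mulVecLin, M.mkQ ∘ₗ augmentation (F.deg 0) F.e,
    ?_, ?_, ?_, ?_, ?_, ?_⟩⟩
  · intro i a b
    refine ⟨F.c i a b, ?_⟩
    rw [Matrix.mulVecLin_apply, Matrix.mulVec_single_one]
    exact hA i a b
  · intro b
    refine ⟨F.e b, ?_⟩
    rw [LinearMap.comp_apply, augmentation_single]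
    rfl
  · intro q
    obtain ⟨p, rfl⟩ := Ideal.Quotient.mk_surjective q
    induction p using MvPolynomial.induction_on' with
    | monomial l r =>
      by_cases hl : l ∈ exponents M
      · refine ⟨0, ?_⟩
        rw [map_zero, eq_comm, Ideal.Quotient.eq_zero_iff_mem, ← mul_one r, ← C_mul_monomial]
        exact M.mul_mem_left _ hl
      · obtain ⟨u, hu, hu1⟩ := F.surjective l hl
        obtain ⟨V, hV⟩ := exists_component_eq (F.deg 0) (Finsupp.single l (r • u))
          (single_mem_below (Submodule.smul_mem _ r hu))
        refine ⟨V, congrArg (Ideal.Quotient.mk M) ?_⟩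
        ext l'
        rw [coeff_augmentation, hV, coeff_monomial, Finsupp.single_apply]
        split_ifs with h
        · rw [dotProduct_smul, hu1, smul_eq_mul, mul_one]
        · simp
    | add p q hp hq =>
      obtain ⟨v, hv⟩ := hp
      obtain ⟨w, hw⟩ := hq
      exact ⟨v + w, by rw [map_add, hv, hw, map_add]⟩
  · refine (exact_iff_component (hA 0)
      (Z := fun v => (M.mkQ ∘ₗ augmentation (F.deg 0) F.e) v = 0)
      (z := fun l u => l ∈ exponents M ∨ F.e ⬝ᵥ u = 0) ?_ ?_).2 F.exact_zero
    · exact mk_augmentation_eq_zero_iff hM (F.deg 0) F.e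
    · simp
  · intro i
    refine (exact_iff_component (hA (i + 1)) (Z := fun v => (A i).mulVecLin v = 0)
      (z := fun _ u => (F.c i).mulVec u = 0) ?_ ?_).2 (F.exact_succ i)
    · intro v
      simp only [← component_mulVec (hA i), Matrix.mulVecLin_apply]
      refine ⟨fun h l => ?_, fun h => component_ext (deg := F.deg i) fun l => ?_⟩
      · rw [h]
        ext
        simp [component]
      · rw [h]
        ext
        simp [component]
    · simp
  · intro i a b h
    rw [Matrix.mulVecLin_apply, Matrix.mulVec_single_one] at h
    have h1 : IsUnit (constantCoeff (A i a b)) := h.map constantCoeff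
    refine h1.ne_zero ?_
    by_cases h0 : F.c i a b = 0
    · simp [A, h0]
    · have : F.deg (i + 1) b - F.deg i a ≠ 0 := fun h' =>
        (F.lt i a b h0).not_ge (tsub_eq_zero_iff_le.1 h')
      simp [A, constantCoeff_monomial, this]

end Translation

/-! ### Betti numbers -/

section Count

universe u v

variable {σ : Type u} {K : Type v} [Field K]

namespace MatrixResolution

variable {I : Set (σ →₀ ℕ)} (F : MatrixResolution K I)

/-- The inclusion of the `n`-th module into the sum of all modules of the resolution. -/
noncomputable def incl (n : ℕ) : (Fin (F.rank n) → K) →ₗ[K] ((i : ℕ) × Fin (F.rank i) →₀ K) :=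
  ∑ a, Finsupp.lsingle ⟨n, a⟩ ∘ₗ LinearMap.proj a

theorem incl_apply (n : ℕ) (u : Fin (F.rank n) → K) :
    F.incl n u = ∑ a, Finsupp.single ⟨n, a⟩ (u a) := by
  simp [incl, LinearMap.sum_apply]

theorem incl_apply_mk (n : ℕ) (u : Fin (F.rank n) → K) (a : Fin (F.rank n)) :
    F.incl n u ⟨n, a⟩ = u a := by
  classical
  simp [incl_apply, Finsupp.finsetSum_apply, Finsupp.single_apply]

theorem incl_apply_ne {n m : ℕ} (h : m ≠ n) (u : Fin (F.rank n) → K) (a : Fin (F.rank m)) :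
    F.incl n u ⟨m, a⟩ = 0 := by
  classical
  rw [incl_apply, Finsupp.finsetSum_apply]
  exact Finset.sum_eq_zero fun b _ => Finsupp.single_eq_of_ne fun h' => h (congrArg Sigma.fst h')

theorem incl_single (n : ℕ) (a : Fin (F.rank n)) :
    F.incl n (Pi.single a 1) = Finsupp.single ⟨n, a⟩ 1 := by
  rw [incl_apply, Finset.sum_eq_single a]
  · simp
  · intro b _ hb
    simp [hb]
  · simp

/-- The sum of the differentials of the resolution. -/
noncomputable def totalD :
    ((i : ℕ) × Fin (F.rank i) →₀ K) →ₗ[K] ((i : ℕ) × Fin (F.rank i) →₀ K) :=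
  Finsupp.linearCombination K fun b => match b with
    | ⟨0, _⟩ => 0
    | ⟨n + 1, b⟩ => F.incl n ((F.c n).mulVec (Pi.single b 1))

theorem totalD_incl_zero (u : Fin (F.rank 0) → K) : F.totalD (F.incl 0 u) = 0 := by
  simp [incl_apply, totalD]

theorem totalD_incl_succ (n : ℕ) (u : Fin (F.rank (n + 1)) → K) :
    F.totalD (F.incl (n + 1) u) = F.incl n ((F.c n).mulVec u) := by
  have : F.totalD ∘ₗ F.incl (n + 1) = F.incl n ∘ₗ (F.c n).mulVecLin := by
    refine LinearMap.pi_ext' fun b => LinearMap.ext_ring ?_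
    simp only [LinearMap.comp_apply, LinearMap.single_apply, incl_single, Matrix.mulVecLin_apply]
    simp [totalD]
  exact LinearMap.congr_fun this u

/-- The augmentation, extended by zero to positive homological degrees. -/
noncomputable def totalε : ((i : ℕ) × Fin (F.rank i) →₀ K) →ₗ[K] K :=
  Finsupp.linearCombination K fun b => match b with
    | ⟨0, b⟩ => F.e b
    | ⟨_ + 1, _⟩ => 0

theorem totalε_incl (u : Fin (F.rank 0) → K) : F.totalε (F.incl 0 u) = F.e ⬝ᵥ u := by
  simp [totalε, incl_apply, dotProduct, mul_comm]

theorem mulVec_mem_below {n : ℕ} {l : σ →₀ ℕ} {u : Fin (F.rank (n + 1)) → K}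
    (hu : u ∈ below (F.deg (n + 1)) l) : (F.c n).mulVec u ∈ below (F.deg n) l := by
  refine mem_below.2 fun a ha => ?_
  obtain ⟨b, -, hb⟩ := Finset.exists_ne_zero_of_sum_ne_zero
    (show ∑ b, F.c n a b * u b ≠ 0 from ha)
  exact (F.lt n a b (left_ne_zero_of_mul hb)).le.trans (mem_below.1 hu b (right_ne_zero_of_mul hb))

theorem single_mem_below_deg {n : ℕ} (b : Fin (F.rank n)) :
    (Pi.single b 1 : Fin (F.rank n) → K) ∈ below (F.deg n) (F.deg n b) := by
  refine mem_below.2 fun a ha => ?_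
  by_cases h : a = b
  · rw [h]
  · exact absurd (Pi.single_eq_of_ne h _) ha

/-- A resolution given by scalar matrices, with the bases of all its modules put together. -/
noncomputable def toScalarComplex : ScalarComplex σ K where
  B := (i : ℕ) × Fin (F.rank i)
  hdeg b := b.1
  deg b := F.deg b.1 b.2
  D := F.totalD
  ε := F.totalε
  D_mem := by
    rintro ⟨n, b⟩
    rw [← incl_single]
    rcases n with _ | n
    · rw [totalD_incl_zero]
      exact Submodule.zero_mem _
    · rw [totalD_incl_succ, Finsupp.mem_supported']
      rintro ⟨m, a⟩ ha
      by_cases hm : m = n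
      · subst hm
        rw [incl_apply_mk, Matrix.mulVec_single_one]
        by_contra h
        exact ha ⟨rfl, F.lt m a b h⟩
      · exact F.incl_apply_ne hm _ _

theorem incl_mem_strand_iff {n : ℕ} {l : σ →₀ ℕ} {u : Fin (F.rank n) → K} :
    F.incl n u ∈ F.toScalarComplex.strand n l ↔ u ∈ below (F.deg n) l := by
  unfold ScalarComplex.strand
  refine (Finsupp.mem_supported' K _).trans ?_
  rw [mem_below]
  constructor
  · intro h a ha
    by_contra hle
    exact ha ((F.incl_apply_mk n u a).symm.trans (h ⟨n, a⟩ fun h' => hle h'.2))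
  · rintro h ⟨m, a⟩ ha
    by_cases hm : m = n
    · subst hm
      refine (F.incl_apply_mk m u a).trans ?_
      by_contra h0
      exact ha ⟨rfl, h a h0⟩
    · exact F.incl_apply_ne hm _ _

theorem exists_eq_incl {n : ℕ} {l : σ →₀ ℕ} {v : (i : ℕ) × Fin (F.rank i) →₀ K}
    (hv : v ∈ F.toScalarComplex.strand n l) :
    ∃ u ∈ below (F.deg n) l, v = F.incl n u := by
  have h : v = F.incl n (fun a => v ⟨n, a⟩) := by
    ext ⟨m, a⟩
    by_cases hm : m = n
    · subst hm
      rw [incl_apply_mk]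
    · rw [incl_apply_ne _ hm]
      exact (Finsupp.mem_supported' K v).1 hv ⟨m, a⟩ fun h => hm h.1
  exact ⟨_, F.incl_mem_strand_iff.1 (h ▸ hv), h⟩

theorem incl_injective (n : ℕ) : Function.Injective (F.incl n) := by
  intro u u' h
  ext a
  rw [← F.incl_apply_mk n u a, h, incl_apply_mk]

theorem incl_eq_zero_iff {n : ℕ} {u : Fin (F.rank n) → K} : F.incl n u = 0 ↔ u = 0 :=
  map_eq_zero_iff _ (F.incl_injective n)

theorem isResolution_toScalarComplex : F.toScalarComplex.IsResolution I where
  finite n := (Set.finite_range fun a : Fin (F.rank n) =>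
    (⟨n, a⟩ : (i : ℕ) × Fin (F.rank i))).subset fun ⟨m, a⟩ hb => by
      have hm : m = n := hb
      subst hm
      exact ⟨a, rfl⟩
  D_D := by
    rintro ⟨n, b⟩
    change F.totalD (F.totalD (Finsupp.single ⟨n, b⟩ 1)) = 0
    rw [← incl_single]
    rcases n with _ | _ | n
    · rw [totalD_incl_zero, map_zero]
    · rw [totalD_incl_succ, totalD_incl_zero]
    · rw [totalD_incl_succ, totalD_incl_succ, incl_eq_zero_iff]
      have hb := F.single_mem_below_deg b
      exact (F.exact_succ n _ _ (F.mulVec_mem_below hb)).2 ⟨_, hb, rfl⟩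
  ε_D := by
    rintro ⟨n, b⟩ hn
    have hn' : n = 1 := hn
    subst hn'
    change _ ∨ F.totalε (F.totalD (Finsupp.single ⟨1, b⟩ 1)) = 0
    rw [← incl_single, totalD_incl_succ, totalε_incl]
    have hb := F.single_mem_below_deg b
    exact (F.exact_zero _ _ (F.mulVec_mem_below hb)).2 ⟨_, hb, rfl⟩
  exact_succ := by
    intro n l v hv h0
    obtain ⟨u, hu, rfl⟩ := F.exists_eq_incl hv
    replace h0 : F.totalD (F.incl (n + 1) u) = 0 := h0
    rw [totalD_incl_succ, incl_eq_zero_iff] at h0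
    obtain ⟨w, hw, hwu⟩ := (F.exact_succ n l u hu).1 h0
    exact ⟨F.incl (n + 2) w, F.incl_mem_strand_iff.2 hw,
      (F.totalD_incl_succ (n + 1) w).trans (congrArg _ hwu)⟩
  exact_zero := by
    intro l v hv h0
    obtain ⟨u, hu, rfl⟩ := F.exists_eq_incl hv
    replace h0 := h0.imp_right (F.totalε_incl u).symm.trans
    obtain ⟨w, hw, hwu⟩ := (F.exact_zero l u hu).1 h0
    exact ⟨F.incl 1 w, F.incl_mem_strand_iff.2 hw,
      (F.totalD_incl_succ 0 w).trans (congrArg _ hwu)⟩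
  surjective := by
    intro l hl
    obtain ⟨u, hu, hu1⟩ := F.surjective l hl
    exact ⟨F.incl 0 u, F.incl_mem_strand_iff.2 hu, (F.totalε_incl u).trans hu1⟩

end MatrixResolution

/-- The number of basis elements of homological degree `k` and multidegree `l`, which may be
negative. -/
noncomputable def ScalarComplex.count (C : ScalarComplex σ K) (k : ℤ) (l : σ → ℤ) : ℕ :=
  Nat.card {b : C.B // (C.hdeg b : ℤ) = k ∧ ∀ x, (C.deg b x : ℤ) = l x}

theorem ScalarComplex.IsResolution.finite_count {C : ScalarComplex σ K} {I : Set (σ →₀ ℕ)}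
    (hC : C.IsResolution I) (k : ℤ) (l : σ → ℤ) :
    Finite {b : C.B // (C.hdeg b : ℤ) = k ∧ ∀ x, (C.deg b x : ℤ) = l x} := by
  refine ((hC.finite k.toNat).subset fun b hb => ?_ : Set.Finite
    {b : C.B | (C.hdeg b : ℤ) = k ∧ ∀ x, (C.deg b x : ℤ) = l x}).to_subtype
  have : (C.hdeg b : ℤ) = k := hb.1
  change C.hdeg b = k.toNat
  omega

theorem ScalarComplex.count_eq {C C' : ScalarComplex σ K} {I : Set (σ →₀ ℕ)} (hI : IsUpperSet I)
    (hC : C.IsResolution I) (hC' : C'.IsResolution I) (k : ℤ) (l : σ → ℤ) :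
    C.count k l = C'.count k l := by
  by_cases h : ∃ (n : ℕ) (m : σ →₀ ℕ), (n : ℤ) = k ∧ ∀ x, (m x : ℤ) = l x
  · obtain ⟨n, m, rfl, hm⟩ := h
    have key : ∀ E : ScalarComplex σ K, E.count n l = Nat.card (E.basisAt n m) := by
      intro E
      refine Nat.card_congr (Equiv.subtypeEquivRight fun b => ?_)
      simp only [← hm, Nat.cast_inj, basisAt, Set.mem_ofPred_eq, DFunLike.ext_iff]
    rw [key, key, card_basisAt_eq hI hC hC']
  · have key : ∀ E : ScalarComplex σ K, E.count k l = 0 := by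
      intro E
      have : IsEmpty {b : E.B // (E.hdeg b : ℤ) = k ∧ ∀ x, (E.deg b x : ℤ) = l x} :=
        ⟨fun b => h ⟨_, _, b.2.1, b.2.2⟩⟩
      exact Nat.card_of_isEmpty
    rw [key, key]

variable {M : Ideal (MvPolynomial σ K)}

theorem mem_exponents_iff_exists_minGens [Finite σ] {l : σ →₀ ℕ} :
    l ∈ exponents M ↔ ∃ g ∈ minGens M, g ≤ l := by
  constructor
  · intro hl
    obtain ⟨g, hgl, hg⟩ := exists_minimal_le_of_wellFoundedLT (· ∈ exponents M) l hl
    exact ⟨g, (minGenSet_finite M).mem_toFinset.2 hg, hgl⟩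
  · rintro ⟨g, hg, hgl⟩
    have hg' : g ∈ minGenSet M := (minGenSet_finite M).mem_toFinset.1 hg
    exact isUpperSet_exponents M hgl hg'.1

theorem exists_isResolution {I : Set (σ →₀ ℕ)} (hI : IsUpperSet I) {L : σ →₀ ℕ}
    (hL : ∀ l, l ∈ I ↔ l ⊓ L ∈ I) :
    ∃ C : ScalarComplex σ K, C.IsResolution I ∧ ∀ b, C.deg b ≤ L := by
  obtain ⟨F, hF⟩ := exists_matrixResolution (K := K) hI hL
  exact ⟨F.toScalarComplex, F.isResolution_toScalarComplex, fun b => hF _ _⟩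

/-- Multigraded Betti numbers can be read off from any scalar complex that is a minimal
resolution. -/
theorem betti_eq_count [Finite σ] (hM : IsMonomialIdeal M) {C : ScalarComplex σ K}
    (hC : C.IsResolution (exponents M)) (k : ℤ) (l : σ → ℤ) : betti M k l = C.count k l := by
  have hne : Nonempty (MinimalFreeResolution M) := by
    obtain ⟨F, -⟩ := exists_matrixResolution (K := K) (isUpperSet_exponents M)
      (L := (minGens M).sup id) fun l => by
        simp only [mem_exponents_iff_exists_minGens, le_inf_iff]
        exact exists_congr fun g => and_congr_right fun hg =>
          ⟨fun h => ⟨h, Finset.le_sup (f := id) hg⟩, fun h => h.1⟩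
    exact F.nonempty_minimalFreeResolution hM
  rw [betti, dif_pos hne]
  exact ScalarComplex.count_eq (isUpperSet_exponents M)
    (hne.some.toMatrixResolution hM).isResolution_toScalarComplex hC k l

/-- The Betti numbers of `M = M₁ + (d)`, where `M₂ = M₁ : d`. The hypotheses on `L` hold if `L` is
the least common multiple of generators of `M₁` and is not divisible by `d`. -/
theorem betti_eq_add_of_exponents_eq_union [Finite σ] {M₁ M₂ : Ideal (MvPolynomial σ K)}
    (hM : IsMonomialIdeal M) (hM₁ : IsMonomialIdeal M₁) (hM₂ : IsMonomialIdeal M₂)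
    {d L : σ →₀ ℕ} (hd : ¬ d ≤ L) (hL : ∀ l, l ∈ exponents M₁ ↔ l ⊓ L ∈ exponents M₁)
    (h : exponents M = exponents M₁ ∪ Set.Ici d) (h₂ : exponents M₂ = {l | l + d ∈ exponents M₁})
    (k : ℤ) (l : σ → ℤ) :
    betti M k l = betti M₁ k l + betti M₂ (k - 1) (fun x => l x - d x) := by
  obtain ⟨C, hC, hCL⟩ := exists_isResolution (K := K) (isUpperSet_exponents M₁) hL
  obtain ⟨G, hG, -⟩ := exists_isResolution (K := K) (isUpperSet_exponents M₂)
    (L := (minGens M₂).sup id) fun l => by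
      simp only [mem_exponents_iff_exists_minGens, le_inf_iff]
      exact exists_congr fun g => and_congr_right fun hg =>
        ⟨fun h => ⟨h, Finset.le_sup (f := id) hg⟩, fun h => h.1⟩
  obtain ⟨F, hF, e, he₁, he₂⟩ := ScalarComplex.exists_isResolution_union
    (isUpperSet_exponents M₁) hC (h₂ ▸ hG) fun b hb => hd (hb.trans (hCL b))
  rw [betti_eq_count hM (h ▸ hF), betti_eq_count hM₁ hC, betti_eq_count hM₂ hG]
  have := hC.finite_count k l
  have := hG.finite_count (k - 1) (fun x => l x - d x)
  unfold ScalarComplex.count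
  rw [← Nat.card_sum]
  refine Nat.card_congr (Equiv.symm ?_)
  let p : C.B ⊕ G.B → Prop := Sum.elim
    (fun b => (C.hdeg b : ℤ) = k ∧ ∀ x, (C.deg b x : ℤ) = l x)
    (fun b => (G.hdeg b : ℤ) = k - 1 ∧ ∀ x, (G.deg b x : ℤ) = l x - d x)
  refine (Equiv.subtypeSum (p := p)).symm.trans (e.subtypeEquiv ?_)
  rintro (b | b)
  · simp [p, he₁]
  · simp [p, he₂, eq_sub_iff_add_eq]

end Count

/-! ### The first structural decomposition -/

section Decomposition

universe u v

variable {σ : Type u} {K : Type v} [Field K]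

/-- The ideal generated by the monomials with exponents in `G`. -/
noncomputable def monomialSpan (K : Type v) [Field K] (G : Set (σ →₀ ℕ)) :
    Ideal (MvPolynomial σ K) :=
  Ideal.span ((fun a => monomial a (1 : K)) '' G)

theorem isMonomialIdeal_monomialSpan (G : Set (σ →₀ ℕ)) : IsMonomialIdeal (monomialSpan K G) :=
  ⟨G, rfl⟩

theorem mem_exponents_monomialSpan {G : Set (σ →₀ ℕ)} {l : σ →₀ ℕ} :
    l ∈ exponents (monomialSpan K G) ↔ ∃ g ∈ G, g ≤ l := by
  classical
  simp [exponents, monomialSpan, mem_ideal_span_monomial_image, coeff_monomial]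

theorem IsMonomialIdeal.ext {M N : Ideal (MvPolynomial σ K)} (hM : IsMonomialIdeal M)
    (hN : IsMonomialIdeal N) (h : exponents M = exponents N) : M = N := by
  ext p
  rw [hM.mem_iff, hN.mem_iff, h]

theorem IsMonomialIdeal.eq_monomialSpan [Finite σ] {M : Ideal (MvPolynomial σ K)}
    (hM : IsMonomialIdeal M) : M = monomialSpan K (minGens M : Set (σ →₀ ℕ)) := by
  refine hM.ext (isMonomialIdeal_monomialSpan _) ?_
  ext l
  rw [mem_exponents_iff_exists_minGens, mem_exponents_monomialSpan]
  rfl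

theorem minGens_monomialSpan_subset [Finite σ] (G : Finset (σ →₀ ℕ)) :
    minGens (monomialSpan K (G : Set (σ →₀ ℕ))) ⊆ G := by
  intro a ha
  have ha' : a ∈ minGenSet (monomialSpan K (G : Set (σ →₀ ℕ))) :=
    (minGenSet_finite _).mem_toFinset.1 ha
  obtain ⟨g, hg, hga⟩ := mem_exponents_monomialSpan.1 ha'.1
  have hg' : g ∈ exponents (monomialSpan K (G : Set (σ →₀ ℕ))) :=
    mem_exponents_monomialSpan.2 ⟨g, hg, le_rfl⟩
  rwa [le_antisymm (ha'.2 hg' hga) hga]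

/-- If `d` has a larger exponent in some variable than all elements of `G`, it does not divide
their least common multiple, which bounds the multidegrees of a minimal resolution, and it can be
split off. The ideal `(G) : d` is generated by the truncated differences `g - d`. -/
theorem betti_monomialSpan_insert [Finite σ] (G : Finset (σ →₀ ℕ)) {d : σ →₀ ℕ} {x : σ}
    (h0 : 0 < d x) (hd : ∀ g ∈ G, g x < d x) (k : ℤ) (l : σ → ℤ) :
    betti (monomialSpan K (insert d (G : Set (σ →₀ ℕ)))) k l =
      betti (monomialSpan K (G : Set (σ →₀ ℕ))) k l +
      betti (monomialSpan K ((fun g => g - d) '' (G : Set (σ →₀ ℕ)))) (k - 1)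
        (fun y => l y - d y) := by
  refine betti_eq_add_of_exponents_eq_union (isMonomialIdeal_monomialSpan _)
    (isMonomialIdeal_monomialSpan _) (isMonomialIdeal_monomialSpan _) (L := G.sup id)
    ?_ ?_ ?_ ?_ k l
  · have : (G.sup id) x < d x := by
      refine Finset.sup_induction (p := fun a : σ →₀ ℕ => a x < d x) ?_ ?_ hd
      · exact h0
      · intro a ha b hb
        rw [Finsupp.sup_apply]
        exact max_lt ha hb
    exact fun h => (h x).not_gt this
  · intro l
    simp only [mem_exponents_monomialSpan, le_inf_iff]
    exact exists_congr fun g => and_congr_right fun hg =>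
      ⟨fun h => ⟨h, Finset.le_sup (f := id) hg⟩, fun h => h.1⟩
  · ext l
    simp [mem_exponents_monomialSpan, or_comm]
  · ext l
    simp [mem_exponents_monomialSpan]

/-- The first structural decomposition of an ideal with generating set `D ∪ H`, in which the
elements of `D` are dominant, after division of all generators by `m`. Splitting off the elements of
`D` one at a time turns `m` into the least common multiple of `m` and a subset of `D`. -/
theorem betti_eq_sum_powerset [Finite σ] [DecidableEq (σ →₀ ℕ)] (D H : Finset (σ →₀ ℕ))
    (m : σ →₀ ℕ)
    (hD : ∀ d ∈ D, ∃ x, m x < d x ∧ (∀ g ∈ H, g x < d x) ∧ ∀ g ∈ D, g ≠ d → g x < d x)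
    (k : ℤ) (l : σ → ℤ) :
    betti (monomialSpan K ((fun g => g - m) '' ((D ∪ H : Finset (σ →₀ ℕ)) : Set (σ →₀ ℕ)))) k l =
      ∑ A ∈ D.powerset,
        betti (monomialSpan K ((fun g => g - (m ⊔ A.sup id)) '' (H : Set (σ →₀ ℕ)))) (k - A.card)
          (fun x => l x - ((m ⊔ A.sup id - m : σ →₀ ℕ) x : ℤ)) := by
  induction D using Finset.induction_on generalizing m k l with
  | empty => simp
  | insert d D hdD ih =>
    obtain ⟨x, hmx, hHx, hDx⟩ := hD d (Finset.mem_insert_self _ _)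
    have hD' : ∀ e ∈ D, ∃ x, m x < e x ∧ (∀ g ∈ H, g x < e x) ∧ ∀ g ∈ D, g ≠ e → g x < e x := by
      intro e he
      obtain ⟨y, h1, h2, h3⟩ := hD e (Finset.mem_insert_of_mem he)
      exact ⟨y, h1, h2, fun g hg => h3 g (Finset.mem_insert_of_mem hg)⟩
    have hD'' : ∀ e ∈ D, ∃ x, (m ⊔ d) x < e x ∧ (∀ g ∈ H, g x < e x) ∧
        ∀ g ∈ D, g ≠ e → g x < e x := by
      intro e he
      obtain ⟨y, h1, h2, h3⟩ := hD e (Finset.mem_insert_of_mem he)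
      refine ⟨y, ?_, h2, fun g hg => h3 g (Finset.mem_insert_of_mem hg)⟩
      rw [Finsupp.sup_apply]
      exact max_lt h1 (h3 d (Finset.mem_insert_self _ _) fun h => hdD (h ▸ he))
    have hlt : ∀ g ∈ D ∪ H, g x < d x := by
      intro g hg
      rcases Finset.mem_union.1 hg with h | h
      · exact hDx g (Finset.mem_insert_of_mem h) fun h' => hdD (h' ▸ h)
      · exact hHx g h
    have himage : (fun g => g - m) '' ((insert d D ∪ H : Finset (σ →₀ ℕ)) : Set (σ →₀ ℕ)) =
        insert (d - m) (((D ∪ H).image fun g => g - m : Finset (σ →₀ ℕ)) : Set (σ →₀ ℕ)) := by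
      rw [Finset.insert_union, Finset.coe_insert, Set.image_insert_eq, Finset.coe_image]
    have himage₂ : (fun g => g - (d - m)) ''
          (((D ∪ H).image fun g => g - m : Finset (σ →₀ ℕ)) : Set (σ →₀ ℕ)) =
        (fun g => g - (m ⊔ d)) '' ((D ∪ H : Finset (σ →₀ ℕ)) : Set (σ →₀ ℕ)) := by
      rw [Finset.coe_image, Set.image_image]
      refine Set.image_congr fun g _ => ?_
      ext y
      simp only [Finsupp.tsub_apply, Finsupp.sup_apply]
      omega
    rw [himage, betti_monomialSpan_insert (x := x), himage₂, Finset.coe_image, ih m hD',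
      ih (m ⊔ d) hD'', Finset.sum_powerset_insert hdD]
    · congr 1
      refine Finset.sum_congr rfl fun A hA => ?_
      have hdA : d ∉ A := fun h => hdD (Finset.mem_powerset.1 hA h)
      rw [Finset.sup_insert, Finset.card_insert_of_notMem hdA, id, sup_assoc]
      congr 1
      · push_cast
        ring
      · ext y
        simp only [Finsupp.tsub_apply, Finsupp.sup_apply]
        omega
    · rw [Finsupp.tsub_apply]
      omega
    · intro g hg
      obtain ⟨g', hg', rfl⟩ := Finset.mem_image.1 hg
      have := hlt g' hg'
      simp only [Finsupp.tsub_apply]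
      omega

theorem quotientIdeal_eq_monomialSpan [Finite σ] (M : Ideal (MvPolynomial σ K)) (m : σ →₀ ℕ) :
    quotientIdeal M m =
      monomialSpan K ((fun g => g - m) '' (nondominantGens M : Set (σ →₀ ℕ))) := by
  have : ∀ g : σ →₀ ℕ, m ⊔ g - m = g - m := by
    intro g
    ext y
    simp only [Finsupp.tsub_apply, Finsupp.sup_apply]
    omega
  simp only [quotientIdeal, monomialSpan, Set.image_image, this]

theorem dominantGens_union_nondominantGens [Finite σ] [DecidableEq (σ →₀ ℕ)]
    (M : Ideal (MvPolynomial σ K)) : dominantGens M ∪ nondominantGens M = minGens M := by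
  classical
  ext a
  simp only [dominantGens, nondominantGens, Finset.mem_union, Finset.mem_filter]
  tauto

/-- The variable in which a dominant generator exceeds the other generators. -/
theorem exists_lt_of_mem_dominantGens [Finite σ] {M : Ideal (MvPolynomial σ K)} {d : σ →₀ ℕ}
    (hd : d ∈ dominantGens M) :
    ∃ x, (∀ g ∈ nondominantGens M, g x < d x) ∧ ∀ g ∈ dominantGens M, g ≠ d → g x < d x := by
  classical
  simp only [dominantGens, nondominantGens, Finset.mem_filter] at hd ⊢
  obtain ⟨hdM, x, hx⟩ := hd
  refine ⟨x, fun g hg => hx g hg.1 ?_, fun g hg hne => hx g hg.1 hne⟩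
  rintro rfl
  exact hg.2 ⟨x, hx⟩

/-- A set of dominant generators can be recovered from its least common multiple. -/
theorem sup_injOn_powerset_dominantGens [Finite σ] {M : Ideal (MvPolynomial σ K)}
    (hM : (nondominantGens M).Nonempty) {A B : Finset (σ →₀ ℕ)} (hA : A ⊆ dominantGens M)
    (hB : B ⊆ dominantGens M) (h : A.sup id = B.sup id) : A = B := by
  have key : ∀ A B : Finset (σ →₀ ℕ), A ⊆ dominantGens M → B ⊆ dominantGens M →
      A.sup id ≤ B.sup id → A ⊆ B := by
    intro A B hA hB h d hd
    by_contra hdB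
    obtain ⟨g, hg⟩ := hM
    obtain ⟨x, hx1, hx2⟩ := exists_lt_of_mem_dominantGens (hA hd)
    have h1 : d x ≤ (B.sup id) x := (Finset.le_sup (f := id) hd).trans h x
    have h2 : (B.sup id) x < d x := by
      refine Finset.sup_induction (p := fun a : σ →₀ ℕ => a x < d x) ?_ ?_ ?_
      · exact (Nat.zero_le _).trans_lt (hx1 g hg)
      · intro a ha b hb
        rw [Finsupp.sup_apply]
        exact max_lt ha hb
      · exact fun b hb => hx2 b (hB hb) fun h => hdB (h ▸ hb)
    exact absurd h1 h2.not_ge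
  exact (key A B hA hB h.le).antisymm (key B A hB hA h.ge)

theorem sum_firstDecomposition [Finite σ] {M : Ideal (MvPolynomial σ K)} (hM : IsMonomialIdeal M)
    (k : ℤ) (l : σ → ℤ) :
    ((firstDecomposition M).map fun t => betti t.I (k - t.j) (fun x => l x - (t.m x : ℤ))).sum =
      betti M k l := by
  classical
  unfold firstDecomposition
  split_ifs with h
  · simp
  · have hne := Finset.nonempty_iff_ne_empty.2 h
    obtain ⟨g₀, hg₀⟩ := hne
    have hinj : Set.InjOn (fun A : Finset (σ →₀ ℕ) => (A.card, A.sup id))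
        ((dominantGens M).powerset : Set (Finset (σ →₀ ℕ))) := by
      intro A hA B hB hAB
      rw [Finset.mem_coe, Finset.mem_powerset] at hA hB
      exact sup_injOn_powerset_dominantGens ⟨g₀, hg₀⟩ hA hB (congrArg Prod.snd hAB)
    rw [Multiset.map_map]
    change ∑ p ∈ shiftSet M, betti (quotientIdeal M p.2) (k - p.1) (fun x => l x - (p.2 x : ℤ)) = _
    have hset : shiftSet M = (dominantGens M).powerset.image fun A => (A.card, A.sup id) := by
      unfold shiftSet
      congr
    rw [hset, Finset.sum_image hinj]
    have key := betti_eq_sum_powerset (K := K) (dominantGens M) (nondominantGens M) 0 (by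
      intro d hd
      obtain ⟨x, h1, h2⟩ := exists_lt_of_mem_dominantGens hd
      exact ⟨x, (Nat.zero_le _).trans_lt (h1 g₀ hg₀), h1, h2⟩) k l
    rw [dominantGens_union_nondominantGens] at key
    conv_rhs => rw [hM.eq_monomialSpan]
    simp only [tsub_zero, Set.image_id'] at key
    rw [key]
    refine Finset.sum_congr rfl fun A _ => ?_
    have : (0 : σ →₀ ℕ) ⊔ A.sup id = A.sup id := sup_eq_right.2 (by simp)
    rw [quotientIdeal_eq_monomialSpan, this]

/-! ### The iterated decomposition -/

theorem isMonomialIdeal_of_mem_firstDecomposition [Finite σ] {M : Ideal (MvPolynomial σ K)}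
    (hM : IsMonomialIdeal M) {t : Term σ K} (ht : t ∈ firstDecomposition M) :
    IsMonomialIdeal t.I := by
  unfold firstDecomposition at ht
  split_ifs at ht
  · rw [Multiset.mem_singleton.1 ht]
    exact hM
  · obtain ⟨p, -, rfl⟩ := Multiset.mem_map.1 ht
    exact quotientIdeal_eq_monomialSpan M p.2 ▸ isMonomialIdeal_monomialSpan _

theorem isDominantIdeal_iff [Finite σ] {M : Ideal (MvPolynomial σ K)} (hM : IsMonomialIdeal M) :
    IsDominantIdeal M ↔ nondominantGens M = ∅ := by
  classical
  simp [IsDominantIdeal, hM, nondominantGens, Finset.filter_eq_empty_iff]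

theorem isPurelyNondominantIdeal_iff [Finite σ] {M : Ideal (MvPolynomial σ K)}
    (hM : IsMonomialIdeal M) : IsPurelyNondominantIdeal M ↔ nondominantGens M = minGens M := by
  classical
  simp [IsPurelyNondominantIdeal, hM, nondominantGens, Finset.filter_eq_self]

theorem firstDecomposition_eq_singleton [Finite σ] {M : Ideal (MvPolynomial σ K)}
    (h : IsDominantIdeal M ∨ IsPurelyNondominantIdeal M) :
    firstDecomposition M = {⟨0, 0, M⟩} := by
  classical
  have hM : IsMonomialIdeal M := h.elim And.left And.left
  rw [isDominantIdeal_iff hM, isPurelyNondominantIdeal_iff hM] at h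
  unfold firstDecomposition
  split_ifs with h0
  · rfl
  · have h1 := h.resolve_left h0
    have h2 : dominantGens M = ∅ := by
      refine Finset.eq_empty_of_forall_notMem fun d hd => ?_
      obtain ⟨x, hx, -⟩ := exists_lt_of_mem_dominantGens hd
      have hdM : d ∈ minGens M := Finset.mem_of_mem_filter d hd
      exact lt_irrefl _ (hx d (h1 ▸ hdM))
    have h3 : shiftSet M = {(0, 0)} := by
      simp [shiftSet, h2, bot_eq_zero]
    have h4 : quotientIdeal M 0 = M := by
      conv_rhs => rw [hM.eq_monomialSpan]
      rw [quotientIdeal_eq_monomialSpan, h1]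
      simp
    simp [h3, h4]

/-- Each ideal of the first structural decomposition has at most as many generators as the original
ideal has nondominant ones, so that it has fewer nondominant generators unless all of its generators
are nondominant. -/
theorem card_nondominantGens_lt [Finite σ] {M : Ideal (MvPolynomial σ K)}
    (hM : IsMonomialIdeal M) {t : Term σ K} (ht : t ∈ firstDecomposition M) :
    (IsDominantIdeal t.I ∨ IsPurelyNondominantIdeal t.I) ∨
      (nondominantGens t.I).card < (nondominantGens M).card := by
  classical
  have hI := isMonomialIdeal_of_mem_firstDecomposition hM ht
  rw [isDominantIdeal_iff hI, isPurelyNondominantIdeal_iff hI]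
  unfold firstDecomposition at ht
  split_ifs at ht with h
  · rw [Multiset.mem_singleton.1 ht]
    exact Or.inl (Or.inl h)
  · obtain ⟨p, -, rfl⟩ := Multiset.mem_map.1 ht
    by_contra hcon
    push Not at hcon
    refine hcon.1.2 (Finset.eq_of_subset_of_card_le (Finset.filter_subset _ _) ?_)
    refine le_trans ?_ hcon.2
    rw [quotientIdeal_eq_monomialSpan, ← Finset.coe_image]
    exact (Finset.card_le_card (minGens_monomialSpan_subset _)).trans Finset.card_image_le

/-- In each step, every ideal is already dominant or purely nondominant, or it is replaced by ideals
with fewer nondominant generators or of these two kinds. -/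
theorem iteratedDecomposition_invariant [Finite σ] {M : Ideal (MvPolynomial σ K)}
    (hM : IsMonomialIdeal M) (r : ℕ) : ∀ t ∈ iteratedDecomposition M r, IsMonomialIdeal t.I ∧
      ((IsDominantIdeal t.I ∨ IsPurelyNondominantIdeal t.I) ∨
        (nondominantGens t.I).card + r ≤ (nondominantGens M).card) := by
  induction r with
  | zero =>
    intro t ht
    rw [Multiset.mem_singleton.1 ht]
    exact ⟨hM, Or.inr le_rfl⟩
  | succ r ih =>
    intro t ht
    obtain ⟨s, hs, ht⟩ := Multiset.mem_bind.1 ht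
    obtain ⟨t', ht', rfl⟩ := Multiset.mem_map.1 ht
    obtain ⟨hsI, hs'⟩ := ih s hs
    refine ⟨isMonomialIdeal_of_mem_firstDecomposition (t := t') hsI ht', ?_⟩
    rcases hs' with hs' | hs'
    · rw [firstDecomposition_eq_singleton hs', Multiset.mem_singleton] at ht'
      exact Or.inl (by rwa [ht'])
    · rcases card_nondominantGens_lt hsI ht' with h | h
      · exact Or.inl h
      · exact Or.inr (by simp only; omega)

theorem sum_iteratedDecomposition [Finite σ] {M : Ideal (MvPolynomial σ K)}
    (hM : IsMonomialIdeal M) (r : ℕ) (k : ℤ) (l : σ → ℤ) :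
    ((iteratedDecomposition M r).map
      fun t => betti t.I (k - t.j) (fun x => l x - (t.m x : ℤ))).sum = betti M k l := by
  induction r with
  | zero => simp [iteratedDecomposition]
  | succ r ih =>
    rw [iteratedDecomposition, Multiset.map_bind, Multiset.sum_bind, ← ih]
    congr 1
    refine Multiset.map_congr rfl fun t ht => ?_
    rw [← sum_firstDecomposition (iteratedDecomposition_invariant hM r t ht).1, Multiset.map_map]
    congr 1
    refine Multiset.map_congr rfl fun t' _ => ?_
    simp [sub_sub]

end Decomposition

end MonomialDecomposition

theorem mainTheorem2 {σ : Type*} {K : Type*} [Finite σ] [Field K]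
    (M : Ideal (MvPolynomial σ K)) (hM : MonomialDecomposition.IsMonomialIdeal M) :
    ∃ 𝒟 𝒩 : Multiset (MonomialDecomposition.Term σ K),
      MonomialDecomposition.iteratedDecomposition M
          (MonomialDecomposition.nondominantGens M).card = 𝒟 + 𝒩 ∧
      (∀ D ∈ 𝒟, MonomialDecomposition.IsDominantIdeal D.I) ∧
      (∀ N ∈ 𝒩, MonomialDecomposition.IsPurelyNondominantIdeal N.I) ∧
      ∀ (k : ℤ) (l : σ →₀ ℕ),
        MonomialDecomposition.betti M k (fun x => (l x : ℤ)) =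
          (𝒟.map (fun D => D.betti k l)).sum + (𝒩.map (fun N => N.betti k l)).sum := by
  classical
  -- an ideal which is both dominant and purely nondominant, such as zero, is counted as dominant
  set p := (MonomialDecomposition.nondominantGens M).card with hp
  set T := MonomialDecomposition.iteratedDecomposition M p with hT
  have hsplit := Multiset.filter_add_not
    (fun t => MonomialDecomposition.IsDominantIdeal t.I) T
  refine ⟨_, _, hsplit.symm, fun D hD => (Multiset.mem_filter.1 hD).2, fun N hN => ?_,
    fun k l => ?_⟩
  · obtain ⟨hNT, hN⟩ := Multiset.mem_filter.1 hN
    obtain ⟨hI, h⟩ := MonomialDecomposition.iteratedDecomposition_invariant hM p N hNT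
    rcases h with h | h
    · exact h.resolve_left hN
    · refine absurd ((MonomialDecomposition.isDominantIdeal_iff hI).2 ?_) hN
      rw [← Finset.card_eq_zero]
      omega
  · rw [← Multiset.sum_add, ← Multiset.map_add, hsplit]
    exact (MonomialDecomposition.sum_iteratedDecomposition hM p k _).symm
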